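/- Let $\mathbb{T}=\mathbb{R}/2\pi\mathbb{Z}$. For a Schwartz distribution $S$ on $\mathbb{T}$ (a continuous linear functional on $C^\infty(\mathbb{T})$) write $\widehat S(n)=S(e^{-int})$, and for a finite complex Borel measure $\mu$ on $\mathbb{T}$ write $\widehat\mu(n)=\int_{\mathbb{T}}e^{-int}\,d\mu(t)$, $n\in\mathbb{Z}$. A set $K$ is said to support a distribution or a measure if its closed support is contained in $K$. Given any real number $q>2$ there is a compact set $K\subset\mathbb{T}$ such that (a) $K$ supports a non-zero distribution $S$ such that $\widehat S\in\ell^q(\mathbb{Z})$; and (b) $K$ does not support any non-zero finite complex Borel measure $\mu$ such that $\widehat\mu\in\ell^q(\mathbb{Z})$. -/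

import Mathlib

open MeasureTheory
open scoped ContDiff

noncomputable section

/-- The circle group `ℝ / 2πℤ`. -/
abbrev CircleGroup : Type := AddCircle (2 * Real.pi)

/-- The space `C^∞` of smooth complex functions on the circle: functions whose pull-back to `ℝ`
(a `2π`-periodic function) is infinitely differentiable. -/
def smoothCircle : Submodule ℂ (CircleGroup → ℂ) where
  carrier := {φ | ContDiff ℝ ∞ (fun t : ℝ => φ (t : CircleGroup))}
  zero_mem' := by
    rw [Set.mem_ofPred_eq]
    exact contDiff_const
  add_mem' hf hg := by
    rw [Set.mem_ofPred_eq] at hf hg ⊢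
    exact hf.add hg
  smul_mem' c _ hf := by
    rw [Set.mem_ofPred_eq] at hf ⊢
    exact contDiff_const.smul hf

/-- The test functions on the circle. -/
abbrev CircleTest : Type := ↥smoothCircle

instance instFunLikeCircleTest : FunLike CircleTest CircleGroup ℂ where
  coe φ := φ.1
  coe_injective _ _ h := Subtype.ext h

/-- A linear functional on the test functions is a (Schwartz) distribution if it is continuous for
the Fréchet topology of `C^∞`, that is, if it is bounded by finitely many of the norms
`φ ↦ sup |φ^(k)|` that define this topology. -/
def IsCircleDistribution (S : CircleTest →ₗ[ℂ] ℂ) : Prop :=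
  ∃ (N : ℕ) (C : ℝ), ∀ φ : CircleTest,
    ‖S φ‖ ≤ C * ∑ k ∈ Finset.range (N + 1),
      ⨆ t : ℝ, ‖iteratedDeriv k (fun x : ℝ => φ (x : CircleGroup)) t‖

/-- The exponential `t ↦ e^{int}` as a test function. -/
def circleExp (n : ℤ) : CircleTest :=
  ⟨fun t => fourier n t, by
    change ContDiff ℝ ∞ (fun t : ℝ => fourier n (t : CircleGroup))
    simp only [fourier_coe_apply]
    have h : ContDiff ℝ ∞ (fun t : ℝ => (t : ℂ)) := Complex.ofRealCLM.contDiff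
    exact ((contDiff_const.mul h).div_const _).cexp⟩

/-- `circleExp n` is indeed `t ↦ e^{int}`. -/
theorem circleExp_apply (n : ℤ) (t : ℝ) :
    circleExp n (t : CircleGroup) = Complex.exp (Complex.I * n * t) := by
  change fourier n (t : CircleGroup) = _
  rw [fourier_coe_apply]
  have h : (Real.pi : ℂ) ≠ 0 := Complex.ofReal_ne_zero.2 Real.pi_ne_zero
  congr 1
  push_cast
  field_simp

/-- The Fourier coefficient `Ŝ(n) = S(e^{-int})` of a distribution. -/
def distFourierCoeff (S : CircleTest →ₗ[ℂ] ℂ) (n : ℤ) : ℂ :=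
  S (circleExp (-n))

/-- The Fourier coefficient `μ̂(n) = ∫ e^{-int} dμ(t)` of a finite complex Borel measure. -/
def measFourierCoeff (μ : ComplexMeasure CircleGroup) (n : ℤ) : ℂ :=
  VectorMeasure.integral μ (fun t => circleExp (-n) t) (ContinuousLinearMap.mul ℝ ℂ)

/-- The closed support of a complex measure: the closed support of its total variation. -/
def measSupport (μ : ComplexMeasure CircleGroup) : Set CircleGroup :=
  μ.variation.support

end

/-! The flat polynomial `flatTrig s a` pairs with a sequence in ℓ^q at a cost of `a * |s|^(1 -
1/q)`, its norm in the dual ℓ^p. Let `K` be a closed set on which such polynomials P_j stay bounded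
with Re P_j ≥ 1 while their ℓ^p norms tend to 0. If μ lives on `K` and μ̂ is in ℓ^q, then ∫ P_j g dμ
→ 0 for every trigonometric polynomial g. Density in L²(|μ|) and the bound on `K` carry this over to
the function h representing μ there, and Re P_j ≥ 1 forces h = 0 (`eq_zero_of_flatTrig`).
Distributions are not controlled by sup bounds on `K` and escape this argument.

The distribution is an infinite product of smooth F_j, each vanishing off the level set of P_j, with
F_j - 1 tiny in ℓ^q. A partial product f_j has an absolutely convergent Fourier series, so by
Young's inequality f_j (F_j - 1) is as small as desired when F_j is chosen after f_j. The
coefficients converge in ℓ^q to a non-zero limit (`exists_distribution_of_localized`).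

To build F (`exists_localized_near_one`), let L be the sum of cos(4^i t), i < N, and R_x the Riesz
product with parameter x. The coefficient of R_x at a frequency with w non-zero digits is (x/2)^w. A
combination of R_x, x in [δ, 2δ], with vanishing moments up to a high order is 1 plus terms of high
weight, which are small in ℓ^q while Nδ^q stays bounded. For the density R_x the sum L has mean
Nx/2, and cutting L off to a window of scale Nδ costs only exp(-cNδ²) in squared L² norm. With δ = λ
N^(-1/q), Nδ^q is fixed but Nδ² = λ² N^(1 - 2/q) → ∞; this is where q > 2 enters. On the window a
multiple of L serves as P, with ℓ^p norm O(1/λ). -/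

instance instFactTwoPiPos : Fact (0 < 2 * Real.pi) := ⟨Real.two_pi_pos⟩

/-! ### Complex measures as functionals on L² of their variation -/

theorem MeasureTheory.ComplexMeasure.isFiniteMeasure_variation {X : Type*} [MeasurableSpace X]
    (μ : ComplexMeasure X) : IsFiniteMeasure μ.variation := by
  set ρ := (ComplexMeasure.re μ).totalVariation + (ComplexMeasure.im μ).totalVariation with hρ
  have hle : μ.variation ≤ ρ := by
    refine VectorMeasure.variation_le_of_forall_enorm_le fun E _ => ?_
    have h1 := SignedMeasure.enorm_le_totalVariation (ComplexMeasure.re μ) E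
    have h2 := SignedMeasure.enorm_le_totalVariation (ComplexMeasure.im μ) E
    rw [hρ, Measure.add_apply]
    refine le_trans ?_ (add_le_add h1 h2)
    have h3 : ‖μ E‖ ≤ ‖ComplexMeasure.re μ E‖ + ‖ComplexMeasure.im μ E‖ := by
      exact Complex.norm_le_abs_re_add_abs_im (μ E)
    rw [← ofReal_norm, ← ofReal_norm, ← ofReal_norm, ← ENNReal.ofReal_add (norm_nonneg _) (norm_nonneg _)]
    exact ENNReal.ofReal_le_ofReal h3
  have : IsFiniteMeasure ρ := by
    have (s : SignedMeasure X) : IsFiniteMeasure s.totalVariation := by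
      unfold SignedMeasure.totalVariation; infer_instance
    rw [hρ]; infer_instance
  exact isFiniteMeasure_of_le ρ hle

/-- The integral of a complex function against a complex measure, as a bounded functional
on `L²` of the total variation. -/
noncomputable def MeasureTheory.ComplexMeasure.integralL2 {X : Type*} [MeasurableSpace X] (μ : ComplexMeasure X)
    [IsFiniteMeasure μ.variation] : StrongDual ℂ (Lp ℂ 2 μ.variation) :=
  LinearMap.mkContinuous
    { toFun := fun f => VectorMeasure.integral μ f (ContinuousLinearMap.mul ℝ ℂ)
      map_add' := fun f g => by
        rw [VectorMeasure.integral_congr_ae (Lp.coeFn_add f g)]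
        exact VectorMeasure.integral_add ((Lp.memLp f).integrable (by norm_num))
          ((Lp.memLp g).integrable (by norm_num))
      map_smul' := fun c f => by
        rw [VectorMeasure.integral_congr_ae (Lp.coeFn_smul c f)]
        refine setToFun_smul _ (fun c s x => ?_) c f
        change (c * x) * _ = c * (x * _)
        ring }
    (μ.variation.real Set.univ ^ (1 / 2 : ℝ)) (fun f => by
      change ‖VectorMeasure.integral μ f (ContinuousLinearMap.mul ℝ ℂ)‖ ≤ _
      have hB : ‖ContinuousLinearMap.mul ℝ ℂ‖ ≤ 1 := ContinuousLinearMap.opNorm_mul_le ℝ ℂ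
      have h0 : 0 ≤ ∫ a, ‖f a‖ ∂μ.variation := integral_nonneg fun _ => norm_nonneg _
      have h1 : ∫ a, ‖f a‖ ∂μ.variation = (eLpNorm f 1 μ.variation).toReal := by
        rw [eLpNorm_one_eq_lintegral_enorm,
          integral_norm_eq_lintegral_enorm (Lp.aestronglyMeasurable f)]
      have h2 := eLpNorm_le_eLpNorm_mul_rpow_measure_univ (μ := μ.variation) (f := f)
        (p := 1) (q := 2) (by norm_num) (Lp.aestronglyMeasurable f)
      have h3 : (eLpNorm f 1 μ.variation).toReal ≤
          μ.variation.real Set.univ ^ (1 / 2 : ℝ) * ‖f‖ := by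
        have hfin : eLpNorm f 2 μ.variation * μ.variation Set.univ ^ (1 / 2 : ℝ) ≠ ⊤ :=
          ENNReal.mul_ne_top (Lp.eLpNorm_ne_top f)
            (ENNReal.rpow_ne_top_of_nonneg (by norm_num) (measure_ne_top _ _))
        norm_num at h2
        refine (ENNReal.toReal_mono hfin (by simpa using h2)).trans ?_
        rw [ENNReal.toReal_mul, ← ENNReal.toReal_rpow, Lp.norm_def, mul_comm]
        rfl
      calc _ ≤ ‖ContinuousLinearMap.mul ℝ ℂ‖ * ∫ a, ‖f a‖ ∂μ.variation :=
            VectorMeasure.norm_integral_le_integral_norm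
        _ ≤ 1 * ∫ a, ‖f a‖ ∂μ.variation := by gcongr
        _ ≤ _ := by rw [one_mul, h1]; exact h3)

theorem MeasureTheory.ComplexMeasure.integralL2_apply {X : Type*} [MeasurableSpace X] (μ : ComplexMeasure X)
    [IsFiniteMeasure μ.variation] (f : Lp ℂ 2 μ.variation) :
    μ.integralL2 f = VectorMeasure.integral μ f (ContinuousLinearMap.mul ℝ ℂ) := rfl

theorem MeasureTheory.ComplexMeasure.eq_zero_of_integralL2_eq_zero {X : Type*} [MeasurableSpace X]
    (μ : ComplexMeasure X) [IsFiniteMeasure μ.variation] (h : μ.integralL2 = 0) : μ = 0 := by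
  ext E hE
  · have h1 : MemLp (E.indicator fun _ => (1 : ℂ)) 2 μ.variation := (memLp_const 1).indicator hE
    have h2 : μ.integralL2 (h1.toLp _) = 0 := by rw [h]; rfl
    rw [ComplexMeasure.integralL2_apply, VectorMeasure.integral_congr_ae h1.coeFn_toLp,
      VectorMeasure.integral_indicator_const _ hE] at h2
    simpa using h2

/-! ### Flat polynomials exclude measures -/

/-- The trigonometric polynomial with constant coefficient `a` and spectrum `s`. -/
noncomputable def flatTrig (s : Finset ℤ) (a : ℝ) : C(CircleGroup, ℂ) :=
  (a : ℂ) • ∑ k ∈ s, fourier k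

/-- Hölder's inequality against the constant 1. The injection `f` allows for the reflection and
translation of the spectrum caused by multiplying by an exponential. -/
theorem sum_norm_le_card_rpow_mul {q : ℝ} (hq : 1 < q) {c : ℤ → ℂ}
    (hc : Summable fun n => ‖c n‖ ^ q) (s : Finset ℤ) {f : ℤ → ℤ} (hf : Function.Injective f) :
    ∑ k ∈ s, ‖c (f k)‖ ≤ (s.card : ℝ) ^ (1 - 1 / q) * (∑' n, ‖c n‖ ^ q) ^ (1 / q) := by
  have hq0 : 0 < q := by linarith
  have h0 : 0 ≤ ∑ k ∈ s, ‖c (f k)‖ := Finset.sum_nonneg fun _ _ => norm_nonneg _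
  have h1 := Real.rpow_sum_le_const_mul_sum_rpow s (fun k => ‖c (f k)‖) hq.le
  simp only [abs_norm] at h1
  have h2 : ∑ k ∈ s, ‖c (f k)‖ ^ q ≤ ∑' n, ‖c n‖ ^ q :=
    (Summable.sum_le_tsum s (fun _ _ => Real.rpow_nonneg (norm_nonneg _) _)
        (hc.comp_injective hf)).trans
      (Summable.tsum_le_tsum_of_inj f hf (fun _ _ => by positivity) (fun _ => le_rfl)
        (hc.comp_injective hf) hc)
  calc ∑ k ∈ s, ‖c (f k)‖ = ((∑ k ∈ s, ‖c (f k)‖) ^ q) ^ (1 / q) := by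
        rw [← Real.rpow_mul h0, mul_one_div_cancel hq0.ne', Real.rpow_one]
    _ ≤ ((s.card : ℝ) ^ (q - 1) * ∑' n, ‖c n‖ ^ q) ^ (1 / q) := by
        gcongr
        exact h1.trans (by gcongr)
    _ = _ := by
        rw [Real.mul_rpow (by positivity) (tsum_nonneg fun _ => by positivity),
          ← Real.rpow_mul (by positivity)]
        congr 2
        field_simp

/-- Multiplication by an exponential only translates the spectrum, so Hölder applies to each term of
`g`. The point is that `C` depends on `g` but not on `s` and `a`. -/
theorem exists_norm_integralL2_flatTrig_mul_le {q : ℝ} (hq : 1 < q) (μ : ComplexMeasure CircleGroup)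
    [IsFiniteMeasure μ.variation] (hμ : Memℓp (measFourierCoeff μ) (ENNReal.ofReal q))
    {g : C(CircleGroup, ℂ)} (hg : g ∈ Submodule.span ℂ (Set.range (@fourier (2 * Real.pi)))) :
    ∃ C : ℝ, 0 ≤ C ∧ ∀ (s : Finset ℤ) (a : ℝ), 0 ≤ a →
      ‖μ.integralL2 (ContinuousMap.toLp 2 μ.variation ℂ (flatTrig s a * g))‖ ≤
        C * (a * (s.card : ℝ) ^ (1 - 1 / q)) := by
  have hq0 : 0 < q := by linarith
  have hsum : Summable fun n => ‖measFourierCoeff μ n‖ ^ q := by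
    have := hμ.summable (by rw [ENNReal.toReal_ofReal hq0.le]; exact hq0)
    rwa [ENNReal.toReal_ofReal hq0.le] at this
  have hcoef (n : ℤ) : μ.integralL2 (ContinuousMap.toLp 2 μ.variation ℂ (fourier n)) =
      measFourierCoeff μ (-n) := by
    rw [ComplexMeasure.integralL2_apply,
      VectorMeasure.integral_congr_ae (ContinuousMap.coeFn_toLp _ _), measFourierCoeff, neg_neg]
    rfl
  induction hg using Submodule.span_induction with
  | mem x hx =>
    obtain ⟨l, rfl⟩ := hx
    refine ⟨(∑' n, ‖measFourierCoeff μ n‖ ^ q) ^ (1 / q),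
      Real.rpow_nonneg (tsum_nonneg fun _ => by positivity) _, fun s a ha => ?_⟩
    have h1 : flatTrig s a * fourier l = (a : ℂ) • ∑ k ∈ s, fourier (k + l) := by
      ext t
      simp [flatTrig, Finset.sum_mul]
    rw [h1, map_smul, map_sum, map_smul, map_sum, norm_smul, Complex.norm_real, Real.norm_eq_abs,
      abs_of_nonneg ha]
    simp only [hcoef]
    have h2 := sum_norm_le_card_rpow_mul hq hsum s (f := fun k => -(k + l))
      (fun x y h => by simpa using h)
    calc _ ≤ a * ((s.card : ℝ) ^ (1 - 1 / q) * (∑' n, ‖measFourierCoeff μ n‖ ^ q) ^ (1 / q)) := by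
          gcongr
          exact (norm_sum_le _ _).trans h2
      _ = _ := by ring
  | zero => exact ⟨0, le_rfl, fun s a _ => by simp⟩
  | add x y _ _ hx hy =>
    obtain ⟨C, hC, h⟩ := hx
    obtain ⟨D, hD, h'⟩ := hy
    refine ⟨C + D, by positivity, fun s a ha => ?_⟩
    rw [mul_add, map_add, map_add, add_mul]
    exact (norm_add_le _ _).trans (add_le_add (h s a ha) (h' s a ha))
  | smul c x _ hx =>
    obtain ⟨C, hC, h⟩ := hx
    refine ⟨‖c‖ * C, by positivity, fun s a ha => ?_⟩
    rw [mul_smul_comm, map_smul, map_smul, norm_smul, mul_assoc]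
    gcongr
    exact h s a ha

theorem norm_sq_le_re_inner_of_ae_eq_mul {X : Type*} [MeasurableSpace X] {m : Measure X}
    {h u : Lp ℂ 2 m} {P : X → ℂ} (hu : u =ᵐ[m] fun t => star (P t) * h t)
    (hP : ∀ᵐ t ∂m, 1 ≤ (P t).re) : ‖h‖ ^ 2 ≤ (inner ℂ u h : ℂ).re := by
  have h4 : ‖h‖ ^ 2 = (inner ℂ h h : ℂ).re := by
    rw [inner_self_eq_norm_sq_to_K]; norm_cast
  have h5 (f : Lp ℂ 2 m) : (inner ℂ f h : ℂ).re = ∫ t, (inner ℂ (f t) (h t) : ℂ).re ∂m := by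
    rw [L2.inner_def]
    exact (integral_re (L2.integrable_inner (𝕜 := ℂ) f h)).symm
  rw [h4, h5, h5]
  refine integral_mono_ae (L2.integrable_inner (𝕜 := ℂ) h h).re
    (L2.integrable_inner (𝕜 := ℂ) u h).re ?_
  filter_upwards [hu, hP] with t ht h6
  rw [ht]
  simp only [RCLike.inner_apply, map_mul, RCLike.star_def, Complex.conj_conj]
  rw [show h t * (P t * (starRingEnd ℂ) (h t)) =
    P t * (h t * (starRingEnd ℂ) (h t)) by ring, Complex.mul_conj,
    Complex.re_mul_ofReal, Complex.ofReal_re]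
  nlinarith [Complex.normSq_nonneg (h t)]

/-- A closed set on which flat trigonometric polynomials of small `ℓ^p` norm stay bounded and
bounded away from zero carries no measure with Fourier transform in the dual space `ℓ^q`. -/
theorem MeasureTheory.ComplexMeasure.eq_zero_of_flatTrig {q B : ℝ} (hq : 1 < q) {K : Set CircleGroup}
    (hK : ∀ ε > 0, ∃ (s : Finset ℤ) (a : ℝ), 0 ≤ a ∧ a * (s.card : ℝ) ^ (1 - 1 / q) ≤ ε ∧
      ∀ t ∈ K, 1 ≤ (flatTrig s a t).re ∧ ‖flatTrig s a t‖ ≤ B)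
    (μ : ComplexMeasure CircleGroup) (hμK : measSupport μ ⊆ K)
    (hμ : Memℓp (measFourierCoeff μ) (ENNReal.ofReal q)) : μ = 0 := by
  have := μ.isFiniteMeasure_variation
  refine μ.eq_zero_of_integralL2_eq_zero ?_
  obtain ⟨h, hh⟩ := (InnerProductSpace.toDual ℂ (Lp ℂ 2 μ.variation)).surjective μ.integralL2
  have hinner (f : Lp ℂ 2 μ.variation) : μ.integralL2 f = inner ℂ h f := by
    rw [← hh]; simp
  suffices h = 0 by rw [← hh, this, map_zero]
  have hae : ∀ᵐ t ∂μ.variation, t ∈ K := by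
    filter_upwards [Measure.support_mem_ae (μ := μ.variation)] with t ht using hμK ht
  have hdense : (Submodule.span ℂ (Set.range (@fourier (2 * Real.pi)))).topologicalClosure = ⊤ :=
    span_fourier_closure_eq_top
  have hdense2 := (ContinuousMap.toLp_denseRange ℂ μ.variation ℂ
    (p := 2) (by norm_num)).topologicalClosure_map_submodule hdense
  -- Here `η` is the error in approximating `h` by a trigonometric polynomial. The absolute value of
  -- `B` covers an empty `K`, where `B` may be negative.
  have hmain (η : ℝ) (hη : 0 < η) : ‖h‖ ^ 2 ≤ |B| * ‖h‖ * η := by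
    obtain ⟨f, hf, hfη⟩ : ∃ f ∈ (Submodule.span ℂ (Set.range (@fourier (2 * Real.pi)))).map
        (ContinuousMap.toLp 2 μ.variation ℂ (E := ℂ)).toLinearMap, dist h f < η := by
      have : h ∈ (((Submodule.span ℂ (Set.range (@fourier (2 * Real.pi)))).map
        (ContinuousMap.toLp 2 μ.variation ℂ (E := ℂ)).toLinearMap).topologicalClosure) := by
        rw [hdense2]; trivial
      exact Metric.mem_closure_iff.1 this η hη
    obtain ⟨g, hg, rfl⟩ := hf
    obtain ⟨C, hC, hCg⟩ := exists_norm_integralL2_flatTrig_mul_le hq μ hμ hg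
    refine le_of_forall_pos_le_add fun ε hε => ?_
    -- The polynomial is chosen after `g`, hence after `C`; `C + 1` avoids division by zero.
    obtain ⟨s, a, ha, hsa, hP⟩ := hK (ε / (C + 1)) (by positivity)
    have hPm : MemLp (fun t => star (flatTrig s a t)) ⊤ μ.variation :=
      memLp_top_of_bound (flatTrig s a).continuous.star.aestronglyMeasurable ‖flatTrig s a‖
        (Filter.Eventually.of_forall fun t => by
          rw [norm_star]; exact ContinuousMap.norm_coe_le_norm _ t)
    -- The conjugate on the left of the inner product becomes P on the right: ⟨u, g⟩ is the integral
    -- of P g against μ, which is small.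
    have hu : MemLp (fun t => star (flatTrig s a t) * h t) 2 μ.variation := (Lp.memLp h).mul hPm
    set u := hu.toLp _
    have hu_ae : u =ᵐ[μ.variation] fun t => star (flatTrig s a t) * h t := hu.coeFn_toLp
    have hnorm : ‖u‖ ≤ |B| * ‖h‖ := by
      refine Lp.norm_le_mul_norm_of_ae_le_mul ?_
      filter_upwards [hu_ae, hae] with t ht htK
      rw [ht, norm_mul, norm_star]
      gcongr
      exact (hP t htK).2.trans (le_abs_self B)
    have hug : inner ℂ u (ContinuousMap.toLp 2 μ.variation ℂ g) =
        μ.integralL2 (ContinuousMap.toLp 2 μ.variation ℂ (flatTrig s a * g)) := by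
      rw [hinner, L2.inner_def, L2.inner_def]
      refine integral_congr_ae ?_
      filter_upwards [hu_ae, ContinuousMap.coeFn_toLp (p := 2) (𝕜 := ℂ) μ.variation g,
        ContinuousMap.coeFn_toLp (p := 2) (𝕜 := ℂ) μ.variation (flatTrig s a * g)]
        with t h1 h2 h3
      rw [h1, h2, h3]
      simp [RCLike.inner_apply]
      ring
    have huh : ‖h‖ ^ 2 ≤ (inner ℂ u h : ℂ).re :=
      norm_sq_le_re_inner_of_ae_eq_mul hu_ae (by filter_upwards [hae] with t ht using (hP t ht).1)
    calc ‖h‖ ^ 2 ≤ (inner ℂ u h : ℂ).re := huh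
      _ = (inner ℂ u (h - ContinuousMap.toLp 2 μ.variation ℂ g) : ℂ).re +
          (inner ℂ u (ContinuousMap.toLp 2 μ.variation ℂ g) : ℂ).re := by
        rw [inner_sub_right, Complex.sub_re]; ring
      _ ≤ |B| * ‖h‖ * η + C * (ε / (C + 1)) := by
        refine add_le_add ((Complex.re_le_norm _).trans ((norm_inner_le_norm _ _).trans ?_))
          ((Complex.re_le_norm _).trans ?_)
        · rw [dist_eq_norm] at hfη
          exact mul_le_mul hnorm hfη.le (norm_nonneg _) (by positivity)
        · rw [hug]
          exact (hCg s a ha).trans (by gcongr)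
      _ ≤ |B| * ‖h‖ * η + ε := by
        gcongr
        rw [mul_div_assoc', div_le_iff₀ (by positivity)]
        nlinarith
  have hle : ‖h‖ ^ 2 ≤ 0 := by
    refine le_of_forall_pos_le_add fun ε hε => ?_
    refine (hmain (ε / (|B| * ‖h‖ + 1)) (by positivity)).trans ?_
    rw [zero_add, mul_div_assoc', div_le_iff₀ (by positivity)]
    nlinarith [mul_nonneg (abs_nonneg B) (norm_nonneg h)]
  exact norm_eq_zero.1 (pow_eq_zero_iff (two_ne_zero) |>.1 (le_antisymm hle (sq_nonneg _)))

/-! ### Fourier coefficients of smooth functions -/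

namespace CircleTest

theorem contDiff (φ : CircleTest) : ContDiff ℝ ∞ (fun t : ℝ => φ (t : CircleGroup)) := φ.2

theorem continuous (φ : CircleTest) : Continuous φ :=
  (QuotientAddGroup.isQuotientMap_mk _).continuous_iff.2 φ.contDiff.continuous

/-- A test function as a continuous function. -/
def toContinuousMap (φ : CircleTest) : C(CircleGroup, ℂ) := ⟨φ, φ.continuous⟩

/-- The pointwise product of test functions. -/
def mul (φ ψ : CircleTest) : CircleTest := ⟨fun t => φ t * ψ t, φ.contDiff.mul ψ.contDiff⟩

theorem mul_apply (φ ψ : CircleTest) (t : CircleGroup) : φ.mul ψ t = φ t * ψ t := rfl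

theorem norm_iteratedDeriv_le_iSup (φ : CircleTest) (k : ℕ) (t : ℝ) :
    ‖iteratedDeriv k (fun x : ℝ => φ (x : CircleGroup)) t‖ ≤
      ⨆ t : ℝ, ‖iteratedDeriv k (fun x : ℝ => φ (x : CircleGroup)) t‖ := by
  -- A real supremum is 0 by convention when the set is unbounded, so boundedness has to be derived,
  -- here from periodicity.
  have hper : Function.Periodic (iteratedDeriv k (fun x : ℝ => φ (x : CircleGroup)))
      (2 * Real.pi) := by
    intro x
    have h := congrFun (iteratedDeriv_comp_add_const k (fun x : ℝ => φ (x : CircleGroup))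
      (2 * Real.pi)) x
    rw [← h]
    congr 1
    funext z
    exact congrArg φ (AddCircle.coe_add_period _ z)
  have hcont : Continuous (iteratedDeriv k (fun x : ℝ => φ (x : CircleGroup))) :=
    φ.contDiff.continuous_iteratedDeriv k (by exact_mod_cast le_top)
  obtain ⟨C, hC⟩ := (hper.isBounded_of_continuous Real.two_pi_pos.ne' hcont).exists_norm_le
  exact le_ciSup (f := fun t : ℝ => ‖iteratedDeriv k (fun x : ℝ => φ (x : CircleGroup)) t‖)
    ⟨C, by rintro _ ⟨x, rfl⟩; exact hC _ ⟨x, rfl⟩⟩ t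

end CircleTest

theorem fourierCoeff_circle_eq (f : CircleGroup → ℂ) (n : ℤ) :
    fourierCoeff f n =
      (1 / (2 * Real.pi)) • ∫ x in (0 : ℝ)..2 * Real.pi, Complex.exp (-(n * Complex.I) * x) * f x := by
  rw [fourierCoeff_eq_intervalIntegral f n 0, zero_add]
  congr 2
  funext x
  have h := circleExp_apply (-n) x
  change fourier (-n) (x : CircleGroup) = _ at h
  rw [h, smul_eq_mul]
  congr 2
  push_cast
  ring

theorem integral_exp_mul_deriv_of_periodic {g g' : ℝ → ℂ} (hg : ∀ x, HasDerivAt g (g' x) x)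
    (hg' : Continuous g') (hper : g (2 * Real.pi) = g 0) (n : ℤ) :
    ∫ x in (0 : ℝ)..2 * Real.pi, Complex.exp (-(n * Complex.I) * x) * g' x =
      n * Complex.I * ∫ x in (0 : ℝ)..2 * Real.pi, Complex.exp (-(n * Complex.I) * x) * g x := by
  have hu (x : ℝ) : HasDerivAt (fun x : ℝ => Complex.exp (-(n * Complex.I) * x))
      (-(n * Complex.I) * Complex.exp (-(n * Complex.I) * x)) x := by
    have h1 : HasDerivAt (fun x : ℝ => -(n * Complex.I) * (x : ℂ)) (-(n * Complex.I)) x := by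
      simpa using (Complex.ofRealCLM.hasDerivAt (x := x)).const_mul (-(n * Complex.I))
    simpa [mul_comm] using h1.cexp
  have hcont : Continuous fun x : ℝ => -(n * Complex.I) * Complex.exp (-(n * Complex.I) * x) := by
    fun_prop
  rw [intervalIntegral.integral_mul_deriv_eq_deriv_mul (fun x _ => hu x) (fun x _ => hg x)
    (hcont.intervalIntegrable _ _) (hg'.intervalIntegrable _ _), hper]
  have h2 : Complex.exp (-(n * Complex.I) * ((2 * Real.pi : ℝ) : ℂ)) = 1 := by
    rw [show -(n * Complex.I) * ((2 * Real.pi : ℝ) : ℂ) = ((-n : ℤ) : ℂ) * (2 * Real.pi * Complex.I) by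
      push_cast; ring]
    exact Complex.exp_int_mul_two_pi_mul_I _
  rw [h2]
  simp only [mul_assoc, neg_mul]
  simp

theorem norm_fourierCoeff_le_of_norm_le {f : CircleGroup → ℂ} {C : ℝ} (hf : ∀ t, ‖f t‖ ≤ C) (n : ℤ) :
    ‖fourierCoeff f n‖ ≤ C := by
  refine (norm_integral_le_of_norm_le_const (C := C) (Filter.Eventually.of_forall fun t => ?_)).trans
    (by simp)
  rw [norm_smul, fourier_apply, Circle.norm_coe, one_mul]
  exact hf t

namespace CircleTest

/-- Two integrations by parts; the boundary terms cancel because the function and its derivative are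
periodic. -/
theorem norm_fourierCoeff_mul_sq_le (φ : CircleTest) (n : ℤ) :
    ‖fourierCoeff φ n‖ * (n : ℝ) ^ 2 ≤
      ⨆ t : ℝ, ‖iteratedDeriv 2 (fun x : ℝ => φ (x : CircleGroup)) t‖ := by
  set M := ⨆ t : ℝ, ‖iteratedDeriv 2 (fun x : ℝ => φ (x : CircleGroup)) t‖
  set g : ℝ → ℂ := fun x : ℝ => φ (x : CircleGroup) with hg
  have hper : Function.Periodic g (2 * Real.pi) := fun z =>
    congrArg φ (AddCircle.coe_add_period _ z)
  have hdper : deriv g (2 * Real.pi) = deriv g 0 := by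
    have h := deriv_comp_add_const g (2 * Real.pi) 0
    rw [zero_add] at h
    rw [← h]
    congr 1
    funext z
    exact hper z
  have hc : ContDiff ℝ ∞ g := φ.contDiff
  have hd1 (x : ℝ) : HasDerivAt g (deriv g x) x :=
    (hc.differentiable (by simp) x).hasDerivAt
  have hc1 : ContDiff ℝ 1 (deriv g) :=
    ContDiff.iterate_deriv' 1 1 (hc.of_le (WithTop.coe_le_coe.2 le_top))
  have hd2 (x : ℝ) : HasDerivAt (deriv g) (deriv (deriv g) x) x :=
    (hc1.differentiable (by simp) x).hasDerivAt
  have e1 := integral_exp_mul_deriv_of_periodic hd1 hc1.continuous (by simpa using hper 0) n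
  have e2 := integral_exp_mul_deriv_of_periodic hd2 (hc1.continuous_deriv le_rfl) hdper n
  rw [e1] at e2
  have h2 : ‖∫ x in (0 : ℝ)..2 * Real.pi, Complex.exp (-(n * Complex.I) * x) * deriv (deriv g) x‖ ≤
      M * |2 * Real.pi - 0| := by
    refine intervalIntegral.norm_integral_le_of_norm_le_const fun x _ => ?_
    have h3 : ‖Complex.exp (-(n * Complex.I) * x)‖ = 1 := by
      rw [Complex.norm_exp]; simp
    rw [norm_mul, h3, one_mul]
    have h4 := φ.norm_iteratedDeriv_le_iSup 2 x
    rwa [show iteratedDeriv 2 (fun x : ℝ => φ (x : CircleGroup)) x = deriv (deriv g) x by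
      rw [iteratedDeriv_succ, iteratedDeriv_one]] at h4
  rw [e2, sub_zero, abs_of_pos Real.two_pi_pos, ← mul_assoc, norm_mul, ← mul_assoc,
    norm_mul, norm_mul, norm_mul, Complex.norm_I, Complex.norm_intCast] at h2
  rw [fourierCoeff_circle_eq, norm_smul, Real.norm_eq_abs, abs_of_pos (by positivity), ← sq_abs]
  change 1 / (2 * Real.pi) * ‖∫ x in (0 : ℝ)..2 * Real.pi, Complex.exp (-(n * Complex.I) * x) * g x‖ *
    |(n : ℝ)| ^ 2 ≤ M
  rw [one_div, inv_mul_eq_div, div_mul_eq_mul_div, div_le_iff₀ Real.two_pi_pos]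
  linarith

/-- The Fourier coefficients of a test function decay quadratically. -/
theorem norm_fourierCoeff_le (φ : CircleTest) (n : ℤ) :
    ‖fourierCoeff φ n‖ ≤ (∑ k ∈ Finset.range 3,
      ⨆ t : ℝ, ‖iteratedDeriv k (fun x : ℝ => φ (x : CircleGroup)) t‖) * (2 / (1 + (n : ℝ) ^ 2)) := by
  set M : ℕ → ℝ := fun k => ⨆ t : ℝ, ‖iteratedDeriv k (fun x : ℝ => φ (x : CircleGroup)) t‖ with hM
  have hpos (k : ℕ) : 0 ≤ M k := Real.iSup_nonneg fun _ => norm_nonneg _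
  have h0 : ‖fourierCoeff φ n‖ ≤ M 0 := by
    refine norm_fourierCoeff_le_of_norm_le (fun t => ?_) n
    induction t using QuotientAddGroup.induction_on with
    | H x => simpa [hM] using φ.norm_iteratedDeriv_le_iSup 0 x
  have h2 := φ.norm_fourierCoeff_mul_sq_le n
  change _ ≤ M 2 at h2
  change _ ≤ (∑ k ∈ Finset.range 3, M k) * _
  rw [mul_div_assoc', le_div_iff₀ (by positivity)]
  simp only [Finset.sum_range_succ, Finset.sum_range_zero]
  nlinarith [hpos 0, hpos 1, hpos 2]

theorem summable_two_div_one_add_sq : Summable fun n : ℤ => 2 / (1 + (n : ℝ) ^ 2) := by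
  have h : Summable fun n : ℤ => 2 * (1 / (n : ℝ) ^ 2) :=
    (Real.summable_one_div_int_pow.2 one_lt_two).mul_left 2
  refine (h.of_norm_bounded_eventually ?_)
  filter_upwards [(Set.finite_singleton (0 : ℤ)).compl_mem_cofinite] with n hn
  have hn' : (n : ℝ) ≠ 0 := by exact_mod_cast hn
  rw [Real.norm_eq_abs, abs_of_pos (by positivity), mul_one_div]
  gcongr
  linarith

theorem summable_norm_fourierCoeff (φ : CircleTest) : Summable fun n => ‖fourierCoeff φ n‖ :=
  Summable.of_nonneg_of_le (fun _ => norm_nonneg _) φ.norm_fourierCoeff_le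
    (summable_two_div_one_add_sq.mul_left _)

end CircleTest

/-! ### Products of functions and convolution in ℓ^p -/

section Young

/-- The Fourier series of `f` converges uniformly, and multiplying by `h` and taking the `n`-th
coefficient is continuous in the sup norm. -/
theorem hasSum_fourierCoeff_mul {f : C(CircleGroup, ℂ)} (hf : Summable fun n => ‖fourierCoeff f n‖)
    (h : C(CircleGroup, ℂ)) (n : ℤ) :
    HasSum (fun k => fourierCoeff f k * fourierCoeff h (n - k)) (fourierCoeff (f * h) n) := by
  let Φ : C(CircleGroup, ℂ) →L[ℂ] ℂ := LinearMap.mkContinuous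
    { toFun := fun g => fourierCoeff (g * h) n
      map_add' := fun a b => by
        have := congrFun (fourierCoeff.add
          (f := ⇑(a * h)) (g := ⇑(b * h)) ((a * h).continuous.integrable_of_hasCompactSupport
            (HasCompactSupport.of_compactSpace _)) ((b * h).continuous.integrable_of_hasCompactSupport
            (HasCompactSupport.of_compactSpace _))) n
        rw [add_mul]
        exact this
      map_smul' := fun c a => by
        rw [smul_mul_assoc]
        exact fourierCoeff.const_smul _ c n } ‖h‖ (fun g => by
          refine norm_fourierCoeff_le_of_norm_le (fun t => ?_) n
          refine (ContinuousMap.norm_coe_le_norm (g * h) t).trans ((norm_mul_le _ _).trans ?_)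
          exact (mul_comm _ _).le)
  have h1 := (hasSum_fourier_series_of_summable (f := f) hf.of_norm).mapL Φ
  have h2 (k : ℤ) : Φ (fourierCoeff f k • fourier k) = fourierCoeff f k * fourierCoeff h (n - k) := by
    rw [map_smul, smul_eq_mul]
    congr 1
    change fourierCoeff (fun t => fourier k t * h t) n = _
    unfold fourierCoeff
    congr 1
    funext t
    rw [smul_eq_mul, smul_eq_mul, ← mul_assoc, ← fourier_add]
    congr 3
    ring
  simp only [h2] at h1
  exact h1

variable {p : ENNReal}

/-- Translation by `k` on `ℓ^p(ℤ)`. -/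
def lpShift (hp : 0 < p.toReal) (k : ℤ) (g : lp (fun _ : ℤ => ℂ) p) : lp (fun _ : ℤ => ℂ) p :=
  ⟨fun n => g (n - k), memℓp_gen (((lp.memℓp g).summable hp).comp_injective sub_left_injective)⟩

theorem norm_lpShift (hp : 0 < p.toReal) (k : ℤ) (g : lp (fun _ : ℤ => ℂ) p) :
    ‖lpShift hp k g‖ = ‖g‖ := by
  rw [lp.norm_eq_tsum_rpow hp, lp.norm_eq_tsum_rpow hp]
  congr 1
  exact (Equiv.subRight k).tsum_eq fun n => ‖g n‖ ^ p.toReal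

/-- Young's inequality: multiplication by an absolutely convergent Fourier series is bounded on
functions with Fourier coefficients in `ℓ^p`. -/
theorem exists_lp_fourierCoeff_mul [Fact (1 ≤ p)] (hp : 0 < p.toReal) {f : C(CircleGroup, ℂ)}
    (hf : Summable fun n => ‖fourierCoeff f n‖) {h : C(CircleGroup, ℂ)} {g : lp (fun _ : ℤ => ℂ) p}
    (hg : ∀ n, g n = fourierCoeff h n) :
    ∃ g' : lp (fun _ : ℤ => ℂ) p, (∀ n, g' n = fourierCoeff (f * h) n) ∧
      ‖g'‖ ≤ (∑' n, ‖fourierCoeff f n‖) * ‖g‖ := by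
  have hnorm (k : ℤ) : ‖fourierCoeff f k • lpShift hp k g‖ = ‖fourierCoeff f k‖ * ‖g‖ := by
    rw [norm_smul, norm_lpShift]
  have hs : Summable fun k => ‖fourierCoeff f k • lpShift hp k g‖ := by
    simp only [hnorm]; exact hf.mul_right _
  refine ⟨∑' k, fourierCoeff f k • lpShift hp k g, fun n => ?_, ?_⟩
  · have h1 := hs.of_norm.hasSum.mapL (lp.evalCLM ℂ (fun _ : ℤ => ℂ) p n)
    refine h1.unique ?_
    have h2 (k : ℤ) : lp.evalCLM ℂ (fun _ : ℤ => ℂ) p n (fourierCoeff f k • lpShift hp k g) =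
        fourierCoeff f k * fourierCoeff h (n - k) := by
      rw [← hg]; rfl
    simp only [h2]
    exact hasSum_fourierCoeff_mul hf h n
  · refine (norm_tsum_le_tsum_norm hs).trans (le_of_eq ?_)
    simp only [hnorm]
    exact tsum_mul_right

end Young

/-! ### Distributions with bounded coefficients -/

theorem summable_mul_fourierCoeff_neg {c : ℤ → ℂ} (hc : ∃ C, ∀ n, ‖c n‖ ≤ C) (φ : CircleTest) :
    Summable fun n => c n * fourierCoeff φ (-n) := by
  obtain ⟨C, hC⟩ := hc
  refine Summable.of_norm_bounded
    ((φ.summable_norm_fourierCoeff.comp_injective neg_injective).mul_left C) fun n => ?_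
  rw [norm_mul]
  exact mul_le_mul_of_nonneg_right (hC n) (norm_nonneg _)

/-- The distribution with a given bounded sequence of Fourier coefficients. -/
noncomputable def distOfCoeff (c : ℤ → ℂ) (hc : ∃ C, ∀ n, ‖c n‖ ≤ C) : CircleTest →ₗ[ℂ] ℂ where
  toFun φ := ∑' n, c n * fourierCoeff φ (-n)
  map_add' φ ψ := by
    have hs := summable_mul_fourierCoeff_neg hc
    rw [← (hs φ).tsum_add (hs ψ)]
    congr 1
    funext n
    have h := congrFun (fourierCoeff.add (f := φ) (g := ψ)
      (φ.continuous.integrable_of_hasCompactSupport (HasCompactSupport.of_compactSpace _))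
      (ψ.continuous.integrable_of_hasCompactSupport (HasCompactSupport.of_compactSpace _))) (-n)
    rw [← mul_add]
    exact congrArg (c n * ·) h
  map_smul' a φ := by
    rw [RingHom.id_apply, smul_eq_mul, ← tsum_mul_left]
    congr 1
    funext n
    have h : fourierCoeff (a • φ : CircleTest) (-n) = a * fourierCoeff φ (-n) :=
      fourierCoeff.const_smul φ a (-n)
    rw [h]
    ring

theorem distOfCoeff_apply (c : ℤ → ℂ) (hc : ∃ C, ∀ n, ‖c n‖ ≤ C) (φ : CircleTest) :
    distOfCoeff c hc φ = ∑' n, c n * fourierCoeff φ (-n) := rfl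

theorem norm_tsum_mul_fourierCoeff_le {c : ℤ → ℂ} {C : ℝ} (hC : ∀ n, ‖c n‖ ≤ C) (φ : CircleTest) :
    ‖∑' n, c n * fourierCoeff φ (-n)‖ ≤ C * ∑' n, ‖fourierCoeff φ n‖ := by
  refine tsum_of_norm_bounded (f := fun n => c n * fourierCoeff φ (-n))
    (g := fun n => C * ‖fourierCoeff φ (-n)‖) ?_ fun n => ?_
  · exact ((Equiv.neg ℤ).hasSum_iff.2 φ.summable_norm_fourierCoeff.hasSum).mul_left C
  · rw [norm_mul]
    gcongr
    exact hC n

theorem isCircleDistribution_distOfCoeff (c : ℤ → ℂ) (hc : ∃ C, ∀ n, ‖c n‖ ≤ C) :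
    IsCircleDistribution (distOfCoeff c hc) := by
  obtain ⟨C, hC⟩ := hc
  have hC0 : 0 ≤ C := (norm_nonneg _).trans (hC 0)
  refine ⟨2, C * ∑' n : ℤ, 2 / (1 + (n : ℝ) ^ 2), fun φ => ?_⟩
  refine (norm_tsum_mul_fourierCoeff_le hC φ).trans ?_
  rw [mul_assoc]
  gcongr
  refine (φ.summable_norm_fourierCoeff.tsum_le_tsum φ.norm_fourierCoeff_le
    (CircleTest.summable_two_div_one_add_sq.mul_left _)).trans (le_of_eq ?_)
  rw [tsum_mul_left, mul_comm]

theorem distFourierCoeff_distOfCoeff (c : ℤ → ℂ) (hc : ∃ C, ∀ n, ‖c n‖ ≤ C) :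
    distFourierCoeff (distOfCoeff c hc) = c := by
  funext n
  rw [distFourierCoeff, distOfCoeff_apply]
  have h : fourierCoeff (circleExp (-n)) = Pi.single (-n) (1 : ℂ) := fourierCoeff_fourier (-n)
  rw [tsum_eq_single n fun m hm => by rw [h, Pi.single_eq_of_ne (by simpa using hm), mul_zero], h,
    Pi.single_eq_same, mul_one]

/-- The convolution formula at frequency 0. It makes the pairing vanish as soon as the pointwise
product does. -/
theorem tsum_fourierCoeff_mul_fourierCoeff_neg (f φ : CircleTest) :
    ∑' n, fourierCoeff f n * fourierCoeff φ (-n) = fourierCoeff (f.mul φ) 0 := by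
  have h := (hasSum_fourierCoeff_mul (f := f.toContinuousMap) f.summable_norm_fourierCoeff
    φ.toContinuousMap 0).tsum_eq
  simp only [zero_sub] at h
  exact h

/-! ### The distribution as an infinite product -/

theorem fourierCoeff_one (n : ℤ) :
    fourierCoeff (1 : CircleGroup → ℂ) n = (Pi.single 0 1 : ℤ → ℂ) n := by
  rw [← fourierCoeff_fourier (T := 2 * Real.pi) 0]
  congr 1
  funext t
  simp

/-- A localized approximate identity for pseudo-measures with coefficients in `ℓ^q` yields a
distribution in `ℓ^q` carried by a set on which flat polynomials stay away from zero. -/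
theorem exists_distribution_of_localized {q B : ℝ} (hq : 1 < q)
    (hkey : ∀ ε > 0, ∃ (s : Finset ℤ) (a : ℝ) (F : CircleTest)
      (g : lp (fun _ : ℤ => ℂ) (ENNReal.ofReal q)), 0 ≤ a ∧
      a * (s.card : ℝ) ^ (1 - 1 / q) ≤ ε ∧
      (∀ t, F t ≠ 0 → 1 ≤ (flatTrig s a t).re ∧ ‖flatTrig s a t‖ ≤ B) ∧
      (∀ n, g n = fourierCoeff (F.toContinuousMap - 1 : C(CircleGroup, ℂ)) n) ∧ ‖g‖ ≤ ε) :
    ∃ K : Set CircleGroup, IsClosed K ∧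
      (∀ ε > 0, ∃ (s : Finset ℤ) (a : ℝ), 0 ≤ a ∧ a * (s.card : ℝ) ^ (1 - 1 / q) ≤ ε ∧
        ∀ t ∈ K, 1 ≤ (flatTrig s a t).re ∧ ‖flatTrig s a t‖ ≤ B) ∧
      ∃ S : CircleTest →ₗ[ℂ] ℂ, IsCircleDistribution S ∧ S ≠ 0 ∧
        Distribution.dsupport S ⊆ K ∧ Memℓp (distFourierCoeff S) (ENNReal.ofReal q) := by
  have hq0 : 0 < q := by linarith
  have : Fact (1 ≤ ENNReal.ofReal q) := ⟨by simpa using ENNReal.ofReal_le_ofReal hq.le⟩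
  have hp : 0 < (ENNReal.ofReal q).toReal := by rwa [ENNReal.toReal_ofReal hq0.le]
  have hp0 : ENNReal.ofReal q ≠ 0 := (zero_lt_one.trans_le Fact.out).ne'
  have hstep (f : CircleTest) (j : ℕ) : ∃ (s : Finset ℤ) (a : ℝ) (F : CircleTest)
      (g : lp (fun _ : ℤ => ℂ) (ENNReal.ofReal q)), 0 ≤ a ∧
      a * (s.card : ℝ) ^ (1 - 1 / q) ≤ 1 / ((j : ℝ) + 1) ∧
      (∀ t, F t ≠ 0 → 1 ≤ (flatTrig s a t).re ∧ ‖flatTrig s a t‖ ≤ B) ∧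
      (∀ n, g n = fourierCoeff (f.mul F) n - fourierCoeff f n) ∧ ‖g‖ ≤ 1 / 4 * (1 / 2) ^ j := by
    set A := ∑' n, ‖fourierCoeff f n‖
    have hA : 0 ≤ A := tsum_nonneg fun _ => norm_nonneg _
    -- The tolerance is divided by `A + 1` because multiplication by `f` enlarges the ℓ^q norm by at
    -- most the factor `A`.
    obtain ⟨s, a, F, g, ha, hsa, hF, hg, hgn⟩ :=
      hkey (min (1 / ((j : ℝ) + 1)) (1 / 4 * (1 / 2) ^ j / (A + 1))) (by positivity)
    obtain ⟨g', hg', hgn'⟩ := exists_lp_fourierCoeff_mul hp (f := f.toContinuousMap)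
      f.summable_norm_fourierCoeff hg
    refine ⟨s, a, F, g', ha, hsa.trans (min_le_left _ _), hF, fun n => ?_, ?_⟩
    · have hsplit : (⇑(f.toContinuousMap * (F.toContinuousMap - 1)) : CircleGroup → ℂ) =
          ⇑(f.mul F) + (-1 : ℂ) • ⇑f := by
        funext t
        change f t * (F t - 1) = f t * F t + (-1 : ℂ) * f t
        ring
      rw [hg', hsplit, fourierCoeff.add
        ((f.mul F).continuous.integrable_of_hasCompactSupport (HasCompactSupport.of_compactSpace _))
        ((f.continuous.const_smul _).integrable_of_hasCompactSupport
          (HasCompactSupport.of_compactSpace _)), Pi.add_apply, fourierCoeff.const_smul]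
      simp [sub_eq_add_neg]
    · refine hgn'.trans ?_
      change A * ‖g‖ ≤ _
      have h1 := hgn.trans (min_le_right _ _)
      rw [le_div_iff₀ (by positivity)] at h1
      nlinarith [norm_nonneg g]
  choose s a F g ha hsa hF hg hgn using hstep
  let one : CircleTest := circleExp 0
  have hone (t : CircleGroup) : one t = 1 := by
    change fourier 0 t = 1
    simp
  let f : ℕ → CircleTest := fun j => Nat.rec one (fun j f => f.mul (F f j)) j
  have hf (j : ℕ) : f (j + 1) = (f j).mul (F (f j) j) := rfl
  let c : ℕ → lp (fun _ : ℤ => ℂ) (ENNReal.ofReal q) := fun j =>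
    lp.single (ENNReal.ofReal q) 0 1 + ∑ i ∈ Finset.range j, g (f i) i
  have hcs (j : ℕ) : c (j + 1) = c j + g (f j) j := by
    simp only [c, Finset.sum_range_succ, add_assoc]
  have hc (j : ℕ) (n : ℤ) : c j n = fourierCoeff (f j) n := by
    induction j with
    | zero =>
      have h1 : (⇑(f 0) : CircleGroup → ℂ) = 1 := funext hone
      rw [h1, fourierCoeff_one]
      simp [c, Pi.single_apply, lp.single_apply]
    | succ j ih =>
      rw [hcs, lp.coeFn_add, Pi.add_apply, ih, hg, hf]
      ring
  have hdist (j : ℕ) : dist (c j) (c (j + 1)) ≤ 1 / 4 * (1 / 2) ^ j := by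
    rw [hcs, dist_self_add_right]
    exact hgn _ _
  obtain ⟨c', hc'⟩ := cauchySeq_tendsto_of_complete
    (cauchySeq_of_le_geometric (1 / 2) (1 / 4) (by norm_num) hdist)
  have hbound (d : lp (fun _ : ℤ => ℂ) (ENNReal.ofReal q)) : ∃ C, ∀ n, ‖d n‖ ≤ C :=
    ⟨‖d‖, fun n => lp.norm_apply_le_norm hp0 d n⟩
  -- The total displacement is at most 1/2, while the zeroth coefficient starts at 1; hence the
  -- limit is not zero.
  have hdist0 : dist (c 0) c' ≤ 1 / 4 / (1 - 1 / 2) :=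
    dist_le_of_le_geometric_of_tendsto₀ (1 / 2) (1 / 4) (by norm_num) hdist hc'
  let Kj : ℕ → Set CircleGroup := fun j =>
    {t | 1 ≤ (flatTrig (s (f j) j) (a (f j) j) t).re ∧ ‖flatTrig (s (f j) j) (a (f j) j) t‖ ≤ B}
  have hKj (j : ℕ) : IsClosed (Kj j) :=
    (isClosed_le continuous_const (Complex.continuous_re.comp (map_continuous _))).inter
      (isClosed_le (map_continuous _).norm continuous_const)
  have hfK (j : ℕ) (t : CircleGroup) (ht : f j t ≠ 0) (i : ℕ) (hi : i < j) : t ∈ Kj i := by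
    induction j with
    | zero => omega
    | succ j ih =>
      rw [hf, CircleTest.mul_apply] at ht
      rcases Nat.lt_succ_iff_lt_or_eq.1 hi with h | rfl
      · exact ih (left_ne_zero_of_mul ht) h
      · exact hF _ _ t (right_ne_zero_of_mul ht)
  have hK : IsClosed (⋂ j, Kj j) := isClosed_iInter hKj
  refine ⟨⋂ j, Kj j, hK, fun ε hε => ?_, distOfCoeff c' (hbound c'),
    isCircleDistribution_distOfCoeff _ _, fun h0 => ?_, ?_, ?_⟩
  · obtain ⟨j, hj⟩ := exists_nat_one_div_lt hε
    exact ⟨s (f j) j, a (f j) j, ha _ _, (hsa _ _).trans hj.le, fun t ht => Set.mem_iInter.1 ht j⟩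
  · have h1 : (c' : ℤ → ℂ) 0 = 0 := by
      rw [← congrFun (distFourierCoeff_distOfCoeff c' (hbound c')) 0, h0]; rfl
    have h2 := lp.norm_apply_le_norm hp0 (c 0 - c') 0
    rw [dist_eq_norm] at hdist0
    replace h2 := h2.trans hdist0
    rw [lp.coeFn_sub, Pi.sub_apply, h1] at h2
    norm_num [c] at h2
  · refine Set.sInter_subset_of_mem ⟨fun φ hφ => ?_, hK⟩
    rw [distOfCoeff_apply]
    have hempty : (tsupport φ) ∩ ⋂ j, Kj j = ∅ := by
      rw [← Set.disjoint_iff_inter_eq_empty]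
      exact Set.disjoint_left.2 fun t ht => hφ ht
    -- By compactness the support of `φ` already misses a finite intersection of the `Kj`, off which
    -- all later partial products vanish.
    obtain ⟨u, hu⟩ := (isClosed_tsupport φ).isCompact.elim_finite_subfamily_closed Kj hKj hempty
    obtain ⟨J, hJ⟩ := u.exists_nat_subset_range
    have hzero (j : ℕ) (hj : J ≤ j) : ∑' n, c j n * fourierCoeff φ (-n) = 0 := by
      simp only [hc]
      rw [tsum_fourierCoeff_mul_fourierCoeff_neg]
      have : (⇑((f j).mul φ) : CircleGroup → ℂ) = 0 := by
        funext t
        rw [CircleTest.mul_apply]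
        by_contra hne
        have h1 : t ∈ tsupport φ := subset_tsupport _ (right_ne_zero_of_mul hne)
        have h2 : t ∈ tsupport φ ∩ ⋂ i ∈ u, Kj i :=
          ⟨h1, Set.mem_iInter₂.2 fun i hi => hfK j t (left_ne_zero_of_mul hne) i
            ((Finset.mem_range.1 (hJ hi)).trans_le hj)⟩
        rw [hu] at h2
        exact h2
      rw [this]
      simp [fourierCoeff]
    have hlim : Filter.Tendsto (fun j => ‖c' - c j‖ * ∑' n, ‖fourierCoeff φ n‖) Filter.atTop
        (nhds 0) := by
      have h1 : Filter.Tendsto (fun j => ‖c' - c j‖) Filter.atTop (nhds 0) := by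
        simp only [← dist_eq_norm, dist_comm c']
        exact tendsto_iff_dist_tendsto_zero.1 hc'
      simpa using h1.mul_const (∑' n, ‖fourierCoeff φ n‖)
    refine norm_le_zero_iff.1 (ge_of_tendsto hlim ?_)
    filter_upwards [Filter.eventually_ge_atTop J] with j hj
    have h3 := norm_tsum_mul_fourierCoeff_le
      (fun n => lp.norm_apply_le_norm hp0 (c' - c j) n) φ
    have h4 : ∑' n, (c' - c j) n * fourierCoeff φ (-n) = ∑' n, c' n * fourierCoeff φ (-n) := by
      have hs (d : lp (fun _ : ℤ => ℂ) (ENNReal.ofReal q)) :=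
        summable_mul_fourierCoeff_neg (hbound d) φ
      simp only [lp.coeFn_sub, Pi.sub_apply, sub_mul]
      rw [(hs c').tsum_sub (hs (c j)), hzero j hj, sub_zero]
    rwa [h4] at h3
  · rw [distFourierCoeff_distOfCoeff]
    exact lp.memℓp c'

/-! ### Lacunary cosines and their independence -/

/-- The function `t ↦ cos (k t)` on the circle. -/
noncomputable def circleCos (k : ℤ) (t : CircleGroup) : ℝ := (fourier k t : ℂ).re

theorem continuous_circleCos (k : ℤ) : Continuous (circleCos k) :=
  Complex.continuous_re.comp (map_continuous _)

theorem circleCos_coe (k : ℤ) (x : ℝ) : circleCos k (x : CircleGroup) = Real.cos (k * x) := by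
  have h := circleExp_apply k x
  change fourier k (x : CircleGroup) = _ at h
  rw [circleCos, h, show Complex.I * k * x = ((k * x : ℝ) : ℂ) * Complex.I by push_cast; ring,
    Complex.exp_ofReal_mul_I_re]

theorem circleCos_zero (t : CircleGroup) : circleCos 0 t = 1 := by simp [circleCos]

theorem abs_circleCos_le_one (k : ℤ) (t : CircleGroup) : |circleCos k t| ≤ 1 := by
  induction t using QuotientAddGroup.induction_on with
  | H x => exact (circleCos_coe k x) ▸ Real.abs_cos_le_one _

theorem circleCos_sq (t : CircleGroup) : circleCos 1 t ^ 2 = 1 / 2 + circleCos 2 t / 2 := by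
  induction t using QuotientAddGroup.induction_on with
  | H x =>
    have h1 := circleCos_coe 1 x
    have h2 := circleCos_coe 2 x
    push_cast at h1 h2
    rw [h1, h2, one_mul, Real.cos_sq]

theorem circleCos_cube (t : CircleGroup) :
    circleCos 1 t ^ 3 = 3 / 4 * circleCos 1 t + circleCos 3 t / 4 := by
  induction t using QuotientAddGroup.induction_on with
  | H x =>
    have h1 := circleCos_coe 1 x
    have h2 := circleCos_coe 3 x
    push_cast at h1 h2
    rw [h1, h2, one_mul, Real.cos_three_mul]
    ring

theorem circleCos_nsmul (k : ℤ) (m : ℕ) (t : CircleGroup) :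
    circleCos k (m • t) = circleCos (k * m) t := by
  simp only [circleCos, fourier_apply]
  rw [← natCast_zsmul, smul_smul]

/-- Translation by 2π/M fixes `h (M • t)` and multiplies e^{ikt} by e^{2πik/M}, which is not 1
because 0 < k < M. The integral equals itself times this factor, so it vanishes. -/
theorem integral_circleCos_mul_comp_nsmul {M : ℕ} {k : ℤ} (hk : 0 < k) (hkM : k < M)
    {h : CircleGroup → ℝ} (hh : Continuous h) :
    ∫ t, circleCos k t * h (M • t) ∂(AddCircle.haarAddCircle) = 0 := by
  have hM : (0 : ℝ) < M := by
    have : (0 : ℤ) < M := hk.trans hkM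
    exact_mod_cast this
  have hMc : (M : ℂ) ≠ 0 := by exact_mod_cast hM.ne'
  have hpi : (Real.pi : ℂ) ≠ 0 := Complex.ofReal_ne_zero.2 Real.pi_ne_zero
  set τ : CircleGroup := ((2 * Real.pi / M : ℝ) : CircleGroup) with hτ
  have hMτ : M • τ = 0 := by
    rw [hτ, ← AddCircle.coe_nsmul, nsmul_eq_mul, mul_div_cancel₀ _ hM.ne', AddCircle.coe_period]
  have hne : (fourier k τ : ℂ) ≠ 1 := by
    have h1 := circleExp_apply k (2 * Real.pi / M)
    change fourier k τ = _ at h1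
    rw [h1, Ne, Complex.exp_eq_one_iff]
    rintro ⟨n, hn⟩
    have h2 : (k : ℂ) = n * M := by
      push_cast at hn
      field_simp at hn
      linear_combination hn
    have h3 : k = n * M := by exact_mod_cast h2
    have h4 : (0 : ℤ) < M := hk.trans hkM
    rcases le_or_gt n 0 with h5 | h5
    · nlinarith
    · nlinarith
  set I := ∫ t, (fourier k t : ℂ) * (h (M • t) : ℂ) ∂(AddCircle.haarAddCircle (T := 2 * Real.pi)) with hI
  have hshift : I = fourier k τ * I := by
    conv_lhs => rw [hI, ← integral_add_right_eq_self _ τ]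
    rw [hI, ← integral_const_mul]
    congr 1
    funext t
    rw [smul_add, hMτ, add_zero]
    simp only [fourier_apply, smul_add, AddCircle.toCircle_add, Circle.coe_mul]
    ring
  have hI0 : I = 0 := by
    have : (1 - (fourier k τ : ℂ)) * I = 0 := by linear_combination hshift
    exact (mul_eq_zero.1 this).resolve_left (sub_ne_zero.2 hne.symm)
  have hint : Integrable (fun t => (fourier k t : ℂ) * (h (M • t) : ℂ))
      (AddCircle.haarAddCircle (T := 2 * Real.pi)) := by
    refine Continuous.integrable_of_hasCompactSupport ?_ (HasCompactSupport.of_compactSpace _)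
    exact (map_continuous _).mul (Complex.continuous_ofReal.comp (hh.comp (continuous_nsmul M)))
  have hre := integral_re hint
  rw [← hI, hI0] at hre
  rw [← Complex.zero_re]
  refine Eq.trans ?_ hre
  congr 1
  funext t
  exact (Complex.re_mul_ofReal _ _).symm

theorem integral_comp_nsmul {M : ℕ} (hM : M ≠ 0) {h : CircleGroup → ℝ} (hh : Continuous h) :
    ∫ t, h (M • t) ∂(AddCircle.haarAddCircle) = ∫ t, h t ∂(AddCircle.haarAddCircle) := by
  have hmp : MeasurePreserving (fun t : CircleGroup => M • t)
      (AddCircle.haarAddCircle (T := 2 * Real.pi)) AddCircle.haarAddCircle := by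
    simpa only [natCast_zsmul] using Measure.measurePreserving_zsmul
      (AddCircle.haarAddCircle (T := 2 * Real.pi)) (Int.natCast_ne_zero.2 hM)
  rw [← hmp.map_eq, integral_map hmp.measurable.aemeasurable hh.aestronglyMeasurable, hmp.map_eq]

/-- Trigonometric polynomials of degree at most three evaluated along the progression `4 ^ i • t`
behave as independent random variables. -/
theorem integral_prod_lacunary (A₀ A₁ A₂ A₃ : ℝ) (N : ℕ) :
    ∫ t, ∏ i ∈ Finset.range N, (A₀ + A₁ * circleCos 1 (4 ^ i • t) + A₂ * circleCos 2 (4 ^ i • t) +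
      A₃ * circleCos 3 (4 ^ i • t)) ∂(AddCircle.haarAddCircle (T := 2 * Real.pi)) = A₀ ^ N := by
  induction N with
  | zero => simp
  | succ N ih =>
    set H : CircleGroup → ℝ := fun t => ∏ i ∈ Finset.range N, (A₀ + A₁ * circleCos 1 (4 ^ i • t) +
      A₂ * circleCos 2 (4 ^ i • t) + A₃ * circleCos 3 (4 ^ i • t)) with hH
    have hHc : Continuous H := by
      have := continuous_circleCos
      fun_prop
    have hcc := continuous_circleCos
    have hint {f : CircleGroup → ℝ} (hf : Continuous f) :
        Integrable f (AddCircle.haarAddCircle (T := 2 * Real.pi)) :=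
      hf.integrable_of_hasCompactSupport (HasCompactSupport.of_compactSpace _)
    have hprod (t : CircleGroup) : ∏ i ∈ Finset.range (N + 1), (A₀ + A₁ * circleCos 1 (4 ^ i • t) +
        A₂ * circleCos 2 (4 ^ i • t) + A₃ * circleCos 3 (4 ^ i • t)) =
        A₀ * (circleCos 0 t * H (4 • t)) + A₁ * (circleCos 1 t * H (4 • t)) +
        A₂ * (circleCos 2 t * H (4 • t)) + A₃ * (circleCos 3 t * H (4 • t)) := by
      -- The factor `i = 0` is split off, since the remaining ones form a function of `4 • t`,
      -- orthogonal to the cosines of frequencies 1, 2, 3.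
      rw [Finset.prod_range_succ', hH]
      simp only [pow_succ, mul_smul, pow_zero, one_smul, circleCos_zero]
      ring
    simp only [hprod]
    rw [integral_add (hint (by fun_prop)) (hint (by fun_prop)),
      integral_add (hint (by fun_prop)) (hint (by fun_prop)),
      integral_add (hint (by fun_prop)) (hint (by fun_prop))]
    simp only [integral_const_mul]
    have h1 := integral_circleCos_mul_comp_nsmul (M := 4) (k := 1) (by norm_num) (by norm_num) hHc
    have h2 := integral_circleCos_mul_comp_nsmul (M := 4) (k := 2) (by norm_num) (by norm_num) hHc
    have h3 := integral_circleCos_mul_comp_nsmul (M := 4) (k := 3) (by norm_num) (by norm_num) hHc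
    rw [h1, h2, h3]
    simp only [circleCos_zero, one_mul]
    rw [integral_comp_nsmul (by norm_num) hHc, ih]
    ring

/-! ### Riesz products and their concentration -/

/-- The lacunary cosine sum `∑_{i < N} cos (4 ^ i t)`. -/
noncomputable def lacunarySum (N : ℕ) (t : CircleGroup) : ℝ :=
  ∑ i ∈ Finset.range N, circleCos 1 (4 ^ i • t)

/-- The Riesz product `∏_{i < N} (1 + x cos (4 ^ i t))`. -/
noncomputable def rieszProd (N : ℕ) (x : ℝ) (t : CircleGroup) : ℝ :=
  ∏ i ∈ Finset.range N, (1 + x * circleCos 1 (4 ^ i • t))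

theorem continuous_lacunarySum (N : ℕ) : Continuous (lacunarySum N) := by
  have := continuous_circleCos
  unfold lacunarySum
  fun_prop

theorem continuous_rieszProd (N : ℕ) (x : ℝ) : Continuous (rieszProd N x) := by
  have := continuous_circleCos
  unfold rieszProd
  fun_prop

theorem exp_mul_lacunarySum (N : ℕ) (u : ℝ) (t : CircleGroup) :
    Real.exp (u * lacunarySum N t) = ∏ i ∈ Finset.range N, Real.exp (u * circleCos 1 (4 ^ i • t)) := by
  rw [lacunarySum, Finset.mul_sum, Real.exp_sum]

theorem exp_le_one_add_add_sq {u : ℝ} (hu : |u| ≤ 1) : Real.exp u ≤ 1 + u + u ^ 2 := by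
  have := (abs_le.1 (Real.abs_exp_sub_one_sub_id_le hu)).2
  linarith

theorem one_add_mul_circleCos_nonneg {x : ℝ} (hx : 0 ≤ x) (hx1 : x ≤ 1) (t : CircleGroup) :
    0 ≤ 1 + x * circleCos 1 t := by
  have := (abs_le.1 (abs_circleCos_le_one 1 t)).1
  nlinarith

theorem rieszProd_nonneg {x : ℝ} (hx : 0 ≤ x) (hx1 : x ≤ 1) (N : ℕ) (t : CircleGroup) :
    0 ≤ rieszProd N x t :=
  Finset.prod_nonneg fun _ _ => one_add_mul_circleCos_nonneg hx hx1 _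

theorem rieszProd_le_exp {x : ℝ} (hx : 0 ≤ x) (hx1 : x ≤ 1) (N : ℕ) (t : CircleGroup) :
    rieszProd N x t ≤ Real.exp (x * lacunarySum N t) := by
  rw [exp_mul_lacunarySum]
  refine Finset.prod_le_prod (fun _ _ => one_add_mul_circleCos_nonneg hx hx1 _) fun i _ => ?_
  rw [add_comm]
  exact Real.add_one_le_exp _

theorem abs_mul_circleCos_le {u : ℝ} (hu : |u| ≤ 1) (t : CircleGroup) : |u * circleCos 1 t| ≤ 1 := by
  rw [abs_mul]
  exact mul_le_one₀ hu (abs_nonneg _) (abs_circleCos_le_one 1 t)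

/-- A Chernoff bound for the lower tail: one factor R is kept as a density, the other is at most
e^{xy}, and 1 ≤ e^{(x/2)(y - L)} supplies a tilt. The result is a product over the scales, whose
integral is explicit. -/
theorem rieszProd_sq_le_of_lacunarySum_le {x y : ℝ} (hx : 0 ≤ x) (hx1 : x ≤ 1) {N : ℕ}
    {t : CircleGroup} (hy : lacunarySum N t ≤ y) :
    rieszProd N x t ^ 2 ≤ Real.exp (3 / 2 * x * y) * ∏ i ∈ Finset.range N,
      ((1 + x * circleCos 1 (4 ^ i • t)) *
        (1 + (-(x / 2)) * circleCos 1 (4 ^ i • t) + ((-(x / 2)) * circleCos 1 (4 ^ i • t)) ^ 2)) := by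
  have h0 := rieszProd_nonneg hx hx1 N t
  have h1 : rieszProd N x t ≤ Real.exp (x * y) :=
    (rieszProd_le_exp hx hx1 N t).trans (by gcongr)
  have h2 : (1 : ℝ) ≤ Real.exp (x / 2 * y) * Real.exp (-(x / 2) * lacunarySum N t) := by
    rw [← Real.exp_add]
    exact Real.one_le_exp (by nlinarith)
  have h3 : Real.exp (-(x / 2) * lacunarySum N t) ≤ ∏ i ∈ Finset.range N,
      (1 + (-(x / 2)) * circleCos 1 (4 ^ i • t) + ((-(x / 2)) * circleCos 1 (4 ^ i • t)) ^ 2) := by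
    rw [exp_mul_lacunarySum]
    refine Finset.prod_le_prod (fun _ _ => (Real.exp_pos _).le) fun i _ => ?_
    exact exp_le_one_add_add_sq (abs_mul_circleCos_le (by rw [abs_le]; constructor <;> linarith) _)
  rw [Finset.prod_mul_distrib]
  change _ ≤ _ * (rieszProd N x t * _)
  calc rieszProd N x t ^ 2 = rieszProd N x t * rieszProd N x t * 1 := by ring
    _ ≤ Real.exp (x * y) * rieszProd N x t *
        (Real.exp (x / 2 * y) * Real.exp (-(x / 2) * lacunarySum N t)) := by gcongr
    _ ≤ Real.exp (x * y) * rieszProd N x t * (Real.exp (x / 2 * y) * ∏ i ∈ Finset.range N,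
        (1 + (-(x / 2)) * circleCos 1 (4 ^ i • t) + ((-(x / 2)) * circleCos 1 (4 ^ i • t)) ^ 2)) := by
      gcongr
    _ = _ := by
      rw [show 3 / 2 * x * y = x * y + x / 2 * y by ring, Real.exp_add]
      ring

/-- The upper tail: R² ≤ e^{2xL} ≤ e^{-xy} e^{3xL}. The quadratic bound for the exponential needs 3x
≤ 1. -/
theorem rieszProd_sq_le_of_le_lacunarySum {x y : ℝ} (hx : 0 ≤ x) (hx1 : x ≤ 1 / 3) {N : ℕ}
    {t : CircleGroup} (hy : y ≤ lacunarySum N t) :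
    rieszProd N x t ^ 2 ≤ Real.exp (-x * y) * ∏ i ∈ Finset.range N,
      (1 + (3 * x) * circleCos 1 (4 ^ i • t) + ((3 * x) * circleCos 1 (4 ^ i • t)) ^ 2) := by
  have h0 := rieszProd_nonneg hx (by linarith) N t
  have h1 := rieszProd_le_exp hx (by linarith) N t
  have h3 : Real.exp (3 * x * lacunarySum N t) ≤ ∏ i ∈ Finset.range N,
      (1 + (3 * x) * circleCos 1 (4 ^ i • t) + ((3 * x) * circleCos 1 (4 ^ i • t)) ^ 2) := by
    rw [exp_mul_lacunarySum]
    refine Finset.prod_le_prod (fun _ _ => (Real.exp_pos _).le) fun i _ => ?_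
    exact exp_le_one_add_add_sq (abs_mul_circleCos_le (by rw [abs_le]; constructor <;> linarith) _)
  calc rieszProd N x t ^ 2 ≤ Real.exp (x * lacunarySum N t) ^ 2 := by gcongr
    _ ≤ Real.exp (-x * y) * Real.exp (3 * x * lacunarySum N t) := by
      rw [← Real.exp_nat_mul, ← Real.exp_add]
      refine Real.exp_le_exp.2 ?_
      push_cast
      nlinarith
    _ ≤ _ := by gcongr

theorem pow_le_exp_of_le_one_add {a b : ℝ} (ha : 0 ≤ a) (hab : a ≤ 1 + b) (N : ℕ) :
    a ^ N ≤ Real.exp (N * b) := by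
  rw [Real.exp_nat_mul]
  exact pow_le_pow_left₀ ha (hab.trans (by rw [add_comm]; exact Real.add_one_le_exp b)) N

/-- The mass of the square of a Riesz product away from the level set on which the Riesz product
itself concentrates. -/
theorem integral_cutoff_mul_rieszProd_sq_le {x δ : ℝ} (hδ : 0 < δ) (hδx : δ ≤ x) (hxδ : x ≤ 2 * δ)
    (hx1 : x ≤ 1 / 3) {N : ℕ} {ψ : CircleGroup → ℝ} (hψc : Continuous ψ) (hψ0 : ∀ t, 0 ≤ ψ t)
    (hψ1 : ∀ t, ψ t ≤ 1) (hψ : ∀ t, ψ t ≠ 0 → lacunarySum N t ≤ N * δ / 24 ∨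
      10 * N * δ ≤ lacunarySum N t) :
    ∫ t, ψ t ^ 2 * rieszProd N x t ^ 2 ∂(AddCircle.haarAddCircle (T := 2 * Real.pi)) ≤
      2 * Real.exp (-(N * δ ^ 2 / 16)) := by
  have hx : 0 ≤ x := hδ.le.trans hδx
  have hcc := continuous_circleCos
  set P₁ : CircleGroup → ℝ := fun t => ∏ i ∈ Finset.range N, ((1 + x * circleCos 1 (4 ^ i • t)) *
        (1 + (-(x / 2)) * circleCos 1 (4 ^ i • t) + ((-(x / 2)) * circleCos 1 (4 ^ i • t)) ^ 2))
    with hP₁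
  set P₂ : CircleGroup → ℝ := fun t => ∏ i ∈ Finset.range N,
      (1 + (3 * x) * circleCos 1 (4 ^ i • t) + ((3 * x) * circleCos 1 (4 ^ i • t)) ^ 2) with hP₂
  have hP₁c : Continuous P₁ := by fun_prop
  have hP₂c : Continuous P₂ := by fun_prop
  have hP₁0 (t : CircleGroup) : 0 ≤ P₁ t := Finset.prod_nonneg fun i _ =>
    mul_nonneg (one_add_mul_circleCos_nonneg hx (by linarith) _)
      (by nlinarith [sq_nonneg ((-(x / 2)) * circleCos 1 (4 ^ i • t) + 1 / 2)])
  have hP₂0 (t : CircleGroup) : 0 ≤ P₂ t := Finset.prod_nonneg fun i _ => by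
    nlinarith [sq_nonneg ((3 * x) * circleCos 1 (4 ^ i • t) + 1 / 2)]
  -- With c the cosine, each factor is 1 + xc/2 - x²c²/4 + x³c³/4. Odd powers have mean 0 and c² has
  -- mean 1/2, which leaves 1 - x²/8 < 1: the source of the decay.
  have hI₁ : ∫ t, P₁ t ∂(AddCircle.haarAddCircle (T := 2 * Real.pi)) = (1 - x ^ 2 / 8) ^ N := by
    rw [← integral_prod_lacunary (1 - x ^ 2 / 8) (x / 2 + 3 / 4 * (x ^ 3 / 4)) (-(x ^ 2 / 8))
      (x ^ 3 / 16) N]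
    refine integral_congr_ae (Filter.Eventually.of_forall fun t => Finset.prod_congr rfl fun i _ => ?_)
    linear_combination (-(x ^ 2 / 4)) * circleCos_sq (4 ^ i • t) +
      (x ^ 3 / 4) * circleCos_cube (4 ^ i • t)
  have hI₂ : ∫ t, P₂ t ∂(AddCircle.haarAddCircle (T := 2 * Real.pi)) = (1 + 9 * x ^ 2 / 2) ^ N := by
    rw [← integral_prod_lacunary (1 + 9 * x ^ 2 / 2) (3 * x) (9 * x ^ 2 / 2) 0 N]
    refine integral_congr_ae (Filter.Eventually.of_forall fun t => Finset.prod_congr rfl fun i _ => ?_)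
    linear_combination (9 * x ^ 2) * circleCos_sq (4 ^ i • t)
  have hint {f : CircleGroup → ℝ} (hf : Continuous f) :
      Integrable f (AddCircle.haarAddCircle (T := 2 * Real.pi)) :=
    hf.integrable_of_hasCompactSupport (HasCompactSupport.of_compactSpace _)
  have hRc := continuous_rieszProd N x
  calc _ ≤ ∫ t, (Real.exp (3 / 2 * x * (N * δ / 24)) * P₁ t + Real.exp (-x * (10 * N * δ)) * P₂ t)
        ∂(AddCircle.haarAddCircle (T := 2 * Real.pi)) := by
        refine integral_mono (hint (by fun_prop)) (hint (by fun_prop)) fun t => ?_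
        have e1 : 0 ≤ Real.exp (3 / 2 * x * (N * δ / 24)) * P₁ t :=
          mul_nonneg (Real.exp_pos _).le (hP₁0 t)
        have e2 : 0 ≤ Real.exp (-x * (10 * N * δ)) * P₂ t :=
          mul_nonneg (Real.exp_pos _).le (hP₂0 t)
        have e3 : ψ t ^ 2 * rieszProd N x t ^ 2 ≤ rieszProd N x t ^ 2 :=
          mul_le_of_le_one_left (sq_nonneg _) (pow_le_one₀ (hψ0 t) (hψ1 t))
        by_cases hz : ψ t = 0
        · simp only [hz]; nlinarith
        · rcases hψ t hz with h | h
          · have := rieszProd_sq_le_of_lacunarySum_le hx (by linarith) h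
            change _ ≤ _ * P₁ t at this
            change ψ t ^ 2 * rieszProd N x t ^ 2 ≤ _
            linarith
          · have := rieszProd_sq_le_of_le_lacunarySum hx hx1 h
            change _ ≤ _ * P₂ t at this
            change ψ t ^ 2 * rieszProd N x t ^ 2 ≤ _
            linarith
    _ = Real.exp (3 / 2 * x * (N * δ / 24)) * (1 - x ^ 2 / 8) ^ N +
        Real.exp (-x * (10 * N * δ)) * (1 + 9 * x ^ 2 / 2) ^ N := by
        rw [integral_add (hint (by fun_prop)) (hint (by fun_prop)), integral_const_mul,
          integral_const_mul, hI₁, hI₂]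
    _ ≤ Real.exp (3 / 2 * x * (N * δ / 24)) * Real.exp (N * (-(x ^ 2 / 8))) +
        Real.exp (-x * (10 * N * δ)) * Real.exp (N * (9 * x ^ 2 / 2)) := by
        gcongr
        · exact pow_le_exp_of_le_one_add (by nlinarith) (by linarith) N
        · exact pow_le_exp_of_le_one_add (by positivity) le_rfl N
    _ ≤ Real.exp (-(N * δ ^ 2 / 16)) + Real.exp (-(N * δ ^ 2 / 16)) := by
        -- Per unit of N, the exponents are xδ/16 - x²/8 ≤ -xδ/16 and -10xδ + 9x²/2 ≤ -xδ, by δ ≤ x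
        -- ≤ 2δ. The window constants 1/24 and 10 are chosen for this.
        have hN : (0 : ℝ) ≤ N := Nat.cast_nonneg N
        have k1 : δ ^ 2 ≤ x * δ := by nlinarith
        have k2 : x * δ ≤ x ^ 2 := by nlinarith
        have k3 : x ^ 2 ≤ 2 * (x * δ) := by nlinarith
        rw [← Real.exp_add, ← Real.exp_add]
        gcongr
        · nlinarith [mul_le_mul_of_nonneg_left k1 hN, mul_le_mul_of_nonneg_left k2 hN]
        · nlinarith [mul_le_mul_of_nonneg_left k1 hN, mul_le_mul_of_nonneg_left k3 hN,
            mul_nonneg hN (sq_nonneg δ)]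
    _ = _ := by ring

/-! ### Vanishing moments by finite differences -/

theorem fwdDiff_iter_inv (n : ℕ) {x : ℝ} (hx : 0 < x) :
    (fwdDiff (1 : ℝ))^[n] (fun y : ℝ => y⁻¹) x =
      (-1) ^ n * n.factorial / ∏ j ∈ Finset.range (n + 1), (x + j) := by
  induction n generalizing x with
  | zero => simp
  | succ n ih =>
    rw [Function.iterate_succ_apply', fwdDiff, ih hx, ih (by linarith)]
    have hpos (y : ℝ) (hy : 0 < y) (m : ℕ) : ∏ j ∈ Finset.range m, (y + j) ≠ 0 :=
      (Finset.prod_pos fun j _ => by positivity).ne'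
    have h1 : ∏ j ∈ Finset.range (n + 1), (x + 1 + j) = ∏ j ∈ Finset.range (n + 1), (x + (j + 1 : ℕ)) :=
      Finset.prod_congr rfl fun j _ => by push_cast; ring
    have h2 : ∏ j ∈ Finset.range (n + 2), (x + j) =
        (∏ j ∈ Finset.range (n + 1), (x + 1 + j)) * x := by
      rw [Finset.prod_range_succ', h1]; simp
    have h3 : ∏ j ∈ Finset.range (n + 2), (x + j) =
        (∏ j ∈ Finset.range (n + 1), (x + j)) * (x + (n + 1 : ℕ)) := Finset.prod_range_succ _ _
    have e1 := hpos x hx (n + 1)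
    have e2 := hpos (x + 1) (by linarith) (n + 1)
    have e3 := hpos x hx (n + 2)
    have h4 : (1 : ℝ) / ∏ j ∈ Finset.range (n + 1), (x + 1 + j) =
        x / ∏ j ∈ Finset.range (n + 2), (x + j) := by
      rw [h2]; field_simp
    have h5 : (1 : ℝ) / ∏ j ∈ Finset.range (n + 1), (x + j) =
        (x + (n + 1 : ℕ)) / ∏ j ∈ Finset.range (n + 2), (x + j) := by
      have : x + (n + 1 : ℕ) ≠ 0 := by positivity
      rw [h3]; field_simp
    rw [div_eq_mul_one_div, h4, div_eq_mul_one_div _ (∏ j ∈ Finset.range (n + 1), (x + j)), h5,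
      Nat.factorial_succ]
    push_cast
    field_simp
    ring

/-- A signed measure on `[1, 2]` of exponentially bounded mass whose moments of orders `1, …, K`
vanish. -/
theorem exists_vanishing_moments {K : ℕ} (hK : 0 < K) :
    ∃ ν s : ℕ → ℝ, (∀ l ∈ Finset.range (K + 1), 1 ≤ s l ∧ s l ≤ 2) ∧
      ∑ l ∈ Finset.range (K + 1), ν l = 1 ∧
      (∀ k, 1 ≤ k → k ≤ K → ∑ l ∈ Finset.range (K + 1), ν l * s l ^ k = 0) ∧
      ∑ l ∈ Finset.range (K + 1), |ν l| ≤ 8 ^ K := by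
  have hKr : (0 : ℝ) < K := by exact_mod_cast hK
  set w : ℕ → ℝ := fun l => (-1) ^ (K - l) * K.choose l with hw
  have hsum (f : ℝ → ℝ) : (fwdDiff (1 : ℝ))^[K] f K =
      ∑ l ∈ Finset.range (K + 1), w l * f (K + l) := by
    rw [fwdDiff_iter_eq_sum_shift]
    refine Finset.sum_congr rfl fun l _ => ?_
    rw [zsmul_eq_mul, nsmul_eq_mul, mul_one]
    push_cast
    rfl
  set D : ℝ := (fwdDiff (1 : ℝ))^[K] (fun y : ℝ => y⁻¹) K with hD
  -- In fact |D| = 1 / (K · C(2K, K)), and the central binomial coefficient is at most 4^K.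
  have hDabs : 1 ≤ K * |D| * 4 ^ K := by
    have h1 : ∏ j ∈ Finset.range (K + 1), ((K : ℝ) + j) =
        (K.factorial * (K + K).choose K : ℕ) * K := by
      rw [← Nat.ascFactorial_eq_factorial_mul_choose, Nat.ascFactorial_eq_prod_range,
        Finset.prod_range_succ']
      push_cast
      rw [add_zero]
      congr 1
      exact Finset.prod_congr rfl fun j _ => by ring
    have h2 : (((K + K).choose K : ℕ) : ℝ) ≤ 4 ^ K := by
      have := Nat.choose_le_two_pow (K + K) K
      rw [← two_mul, pow_mul] at this
      rw [← two_mul]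
      exact_mod_cast this
    have h3 : (0 : ℝ) < ((K + K).choose K : ℕ) := by
      exact_mod_cast Nat.choose_pos (Nat.le_add_left K K)
    have h4 : (0 : ℝ) < K.factorial := by exact_mod_cast K.factorial_pos
    have h5 : |D| = K.factorial / ((K.factorial * (K + K).choose K : ℕ) * K) := by
      rw [hD, fwdDiff_iter_inv K hKr, h1, abs_div, abs_mul, abs_pow, abs_neg, abs_one, one_pow,
        one_mul, abs_of_pos h4, abs_of_pos (by push_cast; positivity)]
    have h6 : (K : ℝ) * |D| * ((K + K).choose K : ℕ) = 1 := by
      rw [h5]; push_cast; field_simp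
    calc (1 : ℝ) = (K : ℝ) * |D| * ((K + K).choose K : ℕ) := h6.symm
      _ ≤ _ := by gcongr
  have hD0 : 0 < |D| := by
    by_contra h
    have : |D| = 0 := le_antisymm (not_lt.1 h) (abs_nonneg _)
    rw [this] at hDabs
    norm_num at hDabs
  have hD0' : D ≠ 0 := abs_pos.1 hD0
  -- The nodes are 1 + l/K, and the weights are those of the K-th difference divided by K + l. The
  -- k-th moment is then a K-th difference of a polynomial of degree k - 1 < K, hence 0, while the
  -- zeroth is D, normalized to 1. The mass is at most 2^K · 4^K.
  refine ⟨fun l => w l * (K + l : ℝ)⁻¹ / D, fun l => (K + l) / K, fun l hl => ?_, ?_, fun k hk hkK => ?_,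
    ?_⟩
  · have hl' : (l : ℝ) ≤ K := by exact_mod_cast Finset.mem_range_succ_iff.1 hl
    rw [le_div_iff₀ hKr, div_le_iff₀ hKr]
    constructor
    · have : (0 : ℝ) ≤ l := Nat.cast_nonneg l
      linarith
    · linarith
  · rw [← Finset.sum_div, ← hsum fun y => y⁻¹]
    exact div_self hD0'
  · have h0 : (fwdDiff (1 : ℝ))^[K] (fun y : ℝ => y ^ (k - 1)) K = 0 :=
      congrFun (fwdDiff_iter_pow_eq_zero_of_lt (R := ℝ) (by omega)) _
    rw [hsum] at h0
    have h1 : ∀ l ∈ Finset.range (K + 1), w l * (K + l : ℝ)⁻¹ / D * ((K + l) / K) ^ k =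
        w l * (K + l : ℝ) ^ (k - 1) * (1 / (D * K ^ k)) := by
      intro l _
      obtain ⟨m, rfl⟩ : ∃ m, k = m + 1 := ⟨k - 1, by omega⟩
      have : (K + l : ℝ) ≠ 0 := by positivity
      rw [Nat.add_sub_cancel, div_pow]
      field_simp
      ring
    rw [Finset.sum_congr rfl h1, ← Finset.sum_mul, h0, zero_mul]
  · have h1 : ∀ l ∈ Finset.range (K + 1), |w l * (K + l : ℝ)⁻¹ / D| ≤ K.choose l * (4 ^ K : ℝ) := by
      intro l _
      rw [abs_div, abs_mul, hw, abs_mul, abs_pow, abs_neg, abs_one, one_pow, one_mul, Nat.abs_cast,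
        abs_of_nonneg (by positivity : (0 : ℝ) ≤ (K + l : ℝ)⁻¹), div_le_iff₀ hD0, mul_assoc]
      gcongr
      have h2 : (K + l : ℝ)⁻¹ ≤ (K : ℝ)⁻¹ := by
        gcongr
        have : (0 : ℝ) ≤ l := Nat.cast_nonneg l
        linarith
      refine h2.trans ?_
      rw [inv_le_iff_one_le_mul₀ hKr]
      linarith
    refine (Finset.sum_le_sum h1).trans (le_of_eq ?_)
    rw [← Finset.sum_mul, ← Nat.cast_sum, Nat.sum_range_choose]
    push_cast
    rw [← mul_pow]
    norm_num

/-! ### Fourier expansion of Riesz products -/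

/-- The exponents `∑ i, e i * 4 ^ i` with digits `e i ∈ {-1, 0, 1}`. -/
def lacunaryFreq {N : ℕ} (e : Fin N → ℤ) : ℤ := ∑ i, e i * 4 ^ (i : ℕ)

/-- The vectors with entries in `{-1, 0, 1}`. -/
def signVectors (N : ℕ) : Finset (Fin N → ℤ) :=
  Fintype.piFinset fun _ => ({-1, 0, 1} : Finset ℤ)

/-- The number of non-zero entries of a sign vector. -/
def signWeight {N : ℕ} (e : Fin N → ℤ) : ℕ := ∑ i, (e i).natAbs

theorem mem_signVectors {N : ℕ} {e : Fin N → ℤ} :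
    e ∈ signVectors N ↔ ∀ i, e i = -1 ∨ e i = 0 ∨ e i = 1 := by
  simp [signVectors, Fintype.mem_piFinset]

/-- Digits -1, 0, 1 are distinct modulo 4, so the frequency determines its lowest digit and, by
induction, the others. -/
theorem lacunaryFreq_injOn (N : ℕ) : Set.InjOn (lacunaryFreq (N := N)) (signVectors N) := by
  induction N with
  | zero => exact fun e _ e' _ _ => Subsingleton.elim _ _
  | succ N ih =>
    intro e he e' he' h
    rw [Finset.mem_coe, mem_signVectors] at he he'
    have hsplit (e : Fin (N + 1) → ℤ) :
        lacunaryFreq e = e 0 + 4 * lacunaryFreq fun i : Fin N => e i.succ := by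
      simp only [lacunaryFreq, Fin.sum_univ_succ, Finset.mul_sum]
      simp only [Fin.val_zero, pow_zero, mul_one, Fin.val_succ, pow_succ]
      congr 1
      exact Finset.sum_congr rfl fun i _ => by ring
    rw [hsplit, hsplit] at h
    have h0 := he 0
    have h0' := he' 0
    have h1 : e 0 = e' 0 := by omega
    have h2 : (fun i : Fin N => e i.succ) = fun i : Fin N => e' i.succ := by
      refine ih ?_ ?_ (by omega)
      · rw [Finset.mem_coe, mem_signVectors]; exact fun i => he i.succ
      · rw [Finset.mem_coe, mem_signVectors]; exact fun i => he' i.succ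
    funext i
    refine Fin.cases h1 (fun i => congrFun h2 i) i

theorem sum_pow_signWeight (N : ℕ) (z : ℝ) :
    ∑ e ∈ signVectors N, z ^ signWeight e = (1 + 2 * z) ^ N := by
  have h := Finset.prod_univ_sum (fun _ : Fin N => ({-1, 0, 1} : Finset ℤ))
    (fun _ j => z ^ j.natAbs)
  simp only [signWeight, signVectors, ← Finset.prod_pow_eq_pow_sum]
  rw [← h]
  simp
  ring

theorem fourier_sum_apply {ι : Type*} (s : Finset ι) (k : ι → ℤ) (t : CircleGroup) :
    (fourier (∑ i ∈ s, k i) t : ℂ) = ∏ i ∈ s, fourier (k i) t := by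
  classical
  induction s using Finset.induction_on with
  | empty => simp
  | insert i s hi ih => rw [Finset.sum_insert hi, Finset.prod_insert hi, fourier_add, ih]

theorem circleCos_nsmul_eq (i : ℕ) (t : CircleGroup) :
    (circleCos 1 (4 ^ i • t) : ℂ) = (fourier (4 ^ i) t + fourier (-4 ^ i) t) / 2 := by
  rw [circleCos_nsmul, circleCos, fourier_neg, ← Complex.re_eq_add_conj]
  simp

theorem rieszProd_eq_sum (N : ℕ) (x : ℝ) (t : CircleGroup) :
    (rieszProd N x t : ℂ) =
      ∑ e ∈ signVectors N, ((x / 2) ^ signWeight e : ℝ) * fourier (lacunaryFreq e) t := by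
  have h := Finset.prod_univ_sum (fun _ : Fin N => ({-1, 0, 1} : Finset ℤ))
    (fun i j => ((x / 2) ^ j.natAbs : ℂ) * fourier (j * 4 ^ (i : ℕ)) t)
  have h2 : ∀ e ∈ signVectors N, ((x / 2) ^ signWeight e : ℝ) * fourier (lacunaryFreq e) t =
      ∏ i, ((x / 2) ^ (e i).natAbs : ℂ) * fourier (e i * 4 ^ (i : ℕ)) t := by
    intro e _
    rw [Finset.prod_mul_distrib, Finset.prod_pow_eq_pow_sum, lacunaryFreq, fourier_sum_apply]
    push_cast
    rfl
  rw [Finset.sum_congr rfl h2, signVectors, ← h, rieszProd, Finset.prod_range]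
  push_cast
  refine Finset.prod_congr rfl fun i _ => ?_
  rw [circleCos_nsmul_eq]
  rw [Finset.sum_insert (by decide), Finset.sum_insert (by decide), Finset.sum_singleton]
  simp only [Int.natAbs_neg, Int.natAbs_one, Int.natAbs_zero, pow_one, pow_zero, neg_mul, one_mul,
    zero_mul, fourier_zero]
  ring

theorem norm_sum_lp_single_comp {p : ENNReal} (hp : 0 < p.toReal) {ι : Type*} {E : Finset ι}
    {φ : ι → ℤ} (hφ : Set.InjOn φ E) (c : ι → ℂ) :
    ‖∑ e ∈ E, lp.single (E := fun _ : ℤ => ℂ) p (φ e) (c e)‖ ^ p.toReal =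
      ∑ e ∈ E, ‖c e‖ ^ p.toReal := by
  classical
  rcases isEmpty_or_nonempty ι with h | h
  · have : E = ∅ := Finset.eq_empty_of_isEmpty E
    subst this
    simp [hp.ne']
  set f : ℤ → ℂ := fun k => c (Function.invFunOn φ E k) with hf
  have hfe : ∀ e ∈ E, f (φ e) = c e := fun e he => by
    rw [hf]; exact congrArg c (hφ.leftInvOn_invFunOn he)
  have h1 : ∑ e ∈ E, lp.single (E := fun _ : ℤ => ℂ) p (φ e) (c e) =
      ∑ k ∈ E.image φ, lp.single p k (f k) := by
    rw [Finset.sum_image hφ]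
    exact Finset.sum_congr rfl fun e he => by rw [hfe e he]
  rw [h1, lp.norm_sum_single hp f, Finset.sum_image hφ]
  exact Finset.sum_congr rfl fun e he => by rw [hfe e he]

/-- A linear combination of Riesz products with the moments of `exists_vanishing_moments` is close
to `1` in the sense of `ℓ^q` norms of Fourier coefficients. -/
theorem exists_lp_combination_rieszProd {q : ℝ} (hq : 0 < q) {K : ℕ} {ν s : ℕ → ℝ} {V : ℝ}
    (hs : ∀ l ∈ Finset.range (K + 1), 1 ≤ s l ∧ s l ≤ 2)
    (h0 : ∑ l ∈ Finset.range (K + 1), ν l = 1)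
    (hmom : ∀ k, 1 ≤ k → k ≤ K → ∑ l ∈ Finset.range (K + 1), ν l * s l ^ k = 0)
    (hV : ∑ l ∈ Finset.range (K + 1), |ν l| ≤ V) (N : ℕ) {δ : ℝ} (hδ : 0 ≤ δ) {z : ℝ} (hz : 1 ≤ z) :
    ∃ g : lp (fun _ : ℤ => ℂ) (ENNReal.ofReal q),
      (∀ n, g n = fourierCoeff (fun t : CircleGroup =>
        ((∑ l ∈ Finset.range (K + 1), ν l * rieszProd N (s l * δ) t - 1 : ℝ) : ℂ)) n) ∧
      ‖g‖ ^ q ≤ V ^ q * (z ^ K)⁻¹ * (1 + 2 * (z * δ ^ q)) ^ N := by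
  classical
  have hV0 : 0 ≤ V := (Finset.sum_nonneg fun _ _ => abs_nonneg _).trans hV
  set m : ℕ → ℝ := fun k => ∑ l ∈ Finset.range (K + 1), ν l * s l ^ k with hm
  set c : (Fin N → ℤ) → ℝ := fun e => (δ / 2) ^ signWeight e * m (signWeight e) with hc
  have hzero : (0 : Fin N → ℤ) ∈ signVectors N := mem_signVectors.2 fun _ => by simp
  have hw0 : signWeight (0 : Fin N → ℤ) = 0 := by simp [signWeight]
  have hf0 : lacunaryFreq (0 : Fin N → ℤ) = 0 := by simp [lacunaryFreq]
  have hc0 : c 0 = 1 := by simp [hc, hw0, hm, h0]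
  have hG : (fun t : CircleGroup =>
      ((∑ l ∈ Finset.range (K + 1), ν l * rieszProd N (s l * δ) t - 1 : ℝ) : ℂ)) =
      ∑ e ∈ (signVectors N).erase 0, (c e : ℂ) • ⇑(fourier (T := 2 * Real.pi) (lacunaryFreq e)) := by
    funext t
    have h1 : ((∑ l ∈ Finset.range (K + 1), ν l * rieszProd N (s l * δ) t : ℝ) : ℂ) =
        ∑ e ∈ signVectors N, (c e : ℂ) * fourier (lacunaryFreq e) t := by
      push_cast
      simp only [rieszProd_eq_sum, Finset.mul_sum]
      rw [Finset.sum_comm]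
      refine Finset.sum_congr rfl fun e _ => ?_
      simp only [hc, hm]
      push_cast
      rw [Finset.mul_sum, Finset.sum_mul]
      refine Finset.sum_congr rfl fun l _ => ?_
      rw [mul_div_assoc, mul_pow]
      ring
    rw [Complex.ofReal_sub, h1, ← Finset.add_sum_erase _ _ hzero, hc0, hf0]
    simp [Finset.sum_apply]
  have hpR : (ENNReal.ofReal q).toReal = q := ENNReal.toReal_ofReal hq.le
  refine ⟨∑ e ∈ (signVectors N).erase 0, lp.single (ENNReal.ofReal q) (lacunaryFreq e) (c e : ℂ),
    fun n => ?_, ?_⟩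
  · rw [hG, fourierCoeff.sum]
    · rw [lp.coeFn_sum, Finset.sum_apply, Finset.sum_apply]
      refine Finset.sum_congr rfl fun e _ => ?_
      rw [fourierCoeff.const_smul, fourierCoeff_fourier, lp.coeFn_single]
      by_cases h : n = lacunaryFreq e
      · subst h; simp
      · simp [h]
    · exact fun e _ => ((map_continuous (fourier (lacunaryFreq e))).const_smul _
        ).integrable_of_hasCompactSupport (HasCompactSupport.of_compactSpace _)
  · have h1 := norm_sum_lp_single_comp (p := ENNReal.ofReal q) (by rwa [hpR])
      ((lacunaryFreq_injOn N).mono (Finset.coe_subset.2 (Finset.erase_subset 0 _)))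
      (fun e => (c e : ℂ))
    rw [hpR] at h1
    rw [h1]
    -- Weights from 1 to K drop out by the moment conditions. For larger weights z^(w - K) ≥ 1 is
    -- inserted, which buys the gain z^{-K} and leaves a sum over all sign vectors that factors.
    have hterm : ∀ e ∈ (signVectors N).erase 0, ‖(c e : ℂ)‖ ^ q ≤
        V ^ q * (z ^ K)⁻¹ * (z * δ ^ q) ^ signWeight e := by
      intro e he
      have hpos : 0 ≤ V ^ q * (z ^ K)⁻¹ * (z * δ ^ q) ^ signWeight e := by positivity
      have hw1 : 1 ≤ signWeight e := by
        by_contra hlt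
        have h2 : signWeight e = 0 := by omega
        refine (Finset.mem_erase.1 he).1 (funext fun i => ?_)
        have := (Finset.sum_eq_zero_iff.1 h2) i (Finset.mem_univ i)
        simpa using this
      rcases le_or_gt (signWeight e) K with hle | hgt
      · have : c e = 0 := by
          simp only [hc, hm]; rw [hmom _ hw1 hle, mul_zero]
        rw [this]
        simpa [hq.ne'] using hpos
      · have hmb : |m (signWeight e)| ≤ V * 2 ^ signWeight e := by
          refine (Finset.abs_sum_le_sum_abs _ _).trans ?_
          refine le_trans (Finset.sum_le_sum fun l hl => ?_)
            ((Finset.sum_mul _ _ _).symm.le.trans (mul_le_mul_of_nonneg_right hV (by positivity)))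
          have hsl := hs l hl
          rw [abs_mul, abs_pow, abs_of_nonneg (by linarith : (0 : ℝ) ≤ s l)]
          gcongr
          · linarith
          · exact hsl.2
        have hcb : ‖(c e : ℂ)‖ ≤ V * δ ^ signWeight e := by
          rw [Complex.norm_real, Real.norm_eq_abs]
          simp only [hc]
          rw [abs_mul, abs_of_nonneg (by positivity)]
          calc _ ≤ (δ / 2) ^ signWeight e * (V * 2 ^ signWeight e) := by gcongr
            _ = V * ((δ / 2) * 2) ^ signWeight e := by rw [mul_pow]; ring
            _ = _ := by rw [div_mul_cancel₀ _ two_ne_zero]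
        calc ‖(c e : ℂ)‖ ^ q ≤ (V * δ ^ signWeight e) ^ q := by gcongr
          _ = V ^ q * (δ ^ q) ^ signWeight e := by
            rw [Real.mul_rpow hV0 (by positivity), ← Real.rpow_natCast, ← Real.rpow_mul hδ,
              mul_comm (signWeight e : ℝ), Real.rpow_mul hδ, Real.rpow_natCast]
          _ ≤ V ^ q * ((z ^ K)⁻¹ * z ^ signWeight e) * (δ ^ q) ^ signWeight e := by
            have : 1 ≤ (z ^ K)⁻¹ * z ^ signWeight e := by
              rw [inv_mul_eq_div, one_le_div (by positivity)]
              exact pow_le_pow_right₀ hz hgt.le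
            gcongr
            exact le_mul_of_one_le_right (by positivity) this
          _ = _ := by rw [mul_pow]; ring
    refine (Finset.sum_le_sum hterm).trans ?_
    rw [← Finset.mul_sum, ← sum_pow_signWeight]
    gcongr
    exact Finset.erase_subset _ _

/-- A square integrable function has Fourier coefficients in `ℓ^q`, `q ≥ 2`, with norm at most
its `L²` norm. -/
theorem exists_lp_of_integral_sq_le {q : ℝ} (hq : 2 ≤ q) {f : C(CircleGroup, ℂ)} {η : ℝ} (hη : 0 ≤ η)
    (hf : ∫ t, ‖f t‖ ^ 2 ∂(AddCircle.haarAddCircle (T := 2 * Real.pi)) ≤ η ^ 2) :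
    ∃ g : lp (fun _ : ℤ => ℂ) (ENNReal.ofReal q), (∀ n, g n = fourierCoeff f n) ∧ ‖g‖ ≤ η := by
  have hpR : (ENNReal.ofReal q).toReal = q := ENNReal.toReal_ofReal (by linarith)
  have hsq : HasSum (fun n => ‖fourierCoeff f n‖ ^ 2)
      (∫ t, ‖f t‖ ^ 2 ∂(AddCircle.haarAddCircle (T := 2 * Real.pi))) := by
    have h := hasSum_sq_fourierCoeff (ContinuousMap.toLp 2 AddCircle.haarAddCircle ℂ f)
    simp only [fourierCoeff_toLp] at h
    convert h using 1
    refine integral_congr_ae ?_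
    filter_upwards [ContinuousMap.coeFn_toLp (p := 2) (𝕜 := ℂ)
      (AddCircle.haarAddCircle (T := 2 * Real.pi)) f] with t ht
    rw [ht]
  have hle (n : ℤ) : ‖fourierCoeff f n‖ ≤ η := by
    refine le_of_sq_le_sq ?_ hη
    exact (le_hasSum hsq n fun _ _ => sq_nonneg _).trans hf
  -- Each coefficient is at most `η`, which absorbs the surplus power `q - 2`; Parseval handles the
  -- squares.
  have hterm (n : ℤ) : ‖fourierCoeff f n‖ ^ q ≤ ‖fourierCoeff f n‖ ^ 2 * η ^ (q - 2) := by
    calc ‖fourierCoeff f n‖ ^ q = ‖fourierCoeff f n‖ ^ (2 : ℝ) * ‖fourierCoeff f n‖ ^ (q - 2) := by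
          rw [← Real.rpow_add_of_nonneg (norm_nonneg _) (by norm_num) (by linarith)]
          congr 1; ring
      _ ≤ _ := by
          rw [Real.rpow_two]
          gcongr
          exact hle n
  have hs : Summable fun n => ‖fourierCoeff f n‖ ^ q :=
    Summable.of_nonneg_of_le (fun _ => by positivity) hterm (hsq.summable.mul_right _)
  refine ⟨⟨fourierCoeff f, memℓp_gen (by rwa [hpR])⟩, fun _ => rfl, ?_⟩
  refine lp.norm_le_of_tsum_le (by rw [hpR]; linarith) hη ?_
  change ∑' n, ‖fourierCoeff f n‖ ^ (ENNReal.ofReal q).toReal ≤ _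
  simp only [hpR]
  calc ∑' n, ‖fourierCoeff f n‖ ^ q ≤ ∑' n, ‖fourierCoeff f n‖ ^ 2 * η ^ (q - 2) :=
        hs.tsum_le_tsum hterm (hsq.summable.mul_right _)
    _ ≤ η ^ 2 * η ^ (q - 2) := by
        rw [tsum_mul_right, hsq.tsum_eq]
        gcongr
    _ = η ^ q := by
        rw [← Real.rpow_two, ← Real.rpow_add_of_nonneg hη (by norm_num) (by linarith)]
        congr 1; ring

/-! ### Localized functions close to 1 -/

/-- The spectrum `{± 4 ^ i : i < N}` of the lacunary cosine sum. -/
def lacunarySpectrum (N : ℕ) : Finset ℤ :=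
  (Finset.range N).image (fun i => (4 : ℤ) ^ i) ∪ (Finset.range N).image fun i => -(4 : ℤ) ^ i

theorem card_lacunarySpectrum_le (N : ℕ) : (lacunarySpectrum N).card ≤ 2 * N := by
  refine (Finset.card_union_le _ _).trans ?_
  have h1 := Finset.card_image_le (s := Finset.range N) (f := fun i => (4 : ℤ) ^ i)
  have h2 := Finset.card_image_le (s := Finset.range N) (f := fun i => -(4 : ℤ) ^ i)
  rw [Finset.card_range] at h1 h2
  omega

theorem flatTrig_lacunarySpectrum (N : ℕ) (a : ℝ) (t : CircleGroup) :
    flatTrig (lacunarySpectrum N) a t = ((2 * a * lacunarySum N t : ℝ) : ℂ) := by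
  have hinj : Function.Injective fun i : ℕ => (4 : ℤ) ^ i :=
    pow_right_injective₀ (by norm_num) (by norm_num)
  have hdisj : Disjoint ((Finset.range N).image (fun i => (4 : ℤ) ^ i))
      ((Finset.range N).image fun i => -(4 : ℤ) ^ i) := by
    rw [Finset.disjoint_left]
    intro k hk hk'
    obtain ⟨i, -, rfl⟩ := Finset.mem_image.1 hk
    obtain ⟨j, -, hj⟩ := Finset.mem_image.1 hk'
    have h1 : (0 : ℤ) < 4 ^ i := by positivity
    have h2 : (0 : ℤ) < 4 ^ j := by positivity
    omega
  rw [flatTrig, lacunarySpectrum, Finset.sum_union hdisj, Finset.sum_image hinj.injOn,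
    Finset.sum_image (fun i _ j _ h => hinj (neg_injective h)), ← Finset.sum_add_distrib,
    ContinuousMap.smul_apply, ContinuousMap.sum_apply, lacunarySum]
  push_cast
  rw [Finset.mul_sum, Finset.smul_sum]
  refine Finset.sum_congr rfl fun i _ => ?_
  rw [circleCos_nsmul_eq, Pi.add_apply, smul_eq_mul]
  ring

theorem contDiff_circleCos_nsmul (i : ℕ) :
    ContDiff ℝ ∞ fun x : ℝ => circleCos 1 (4 ^ i • (x : CircleGroup)) := by
  simp only [circleCos_nsmul, circleCos_coe]
  exact Real.contDiff_cos.comp (contDiff_const.mul contDiff_id)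

/-- A smooth cutoff function, equal to `1` on `[a, b]` and vanishing outside `(a / 2, 2 b)`. -/
noncomputable def smoothWindow (a b y : ℝ) : ℝ :=
  Real.smoothTransition (2 * y / a - 1) * Real.smoothTransition (2 - y / b)

theorem contDiff_smoothWindow (a b : ℝ) : ContDiff ℝ ∞ (smoothWindow a b) := by
  have h : ContDiff ℝ ∞ Real.smoothTransition := Real.smoothTransition.contDiff
  exact (h.comp (((contDiff_const.mul contDiff_id).div_const a).sub contDiff_const)).mul
    (h.comp (contDiff_const.sub (contDiff_id.div_const b)))

theorem smoothWindow_nonneg (a b y : ℝ) : 0 ≤ smoothWindow a b y :=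
  mul_nonneg (Real.smoothTransition.nonneg _) (Real.smoothTransition.nonneg _)

theorem smoothWindow_le_one (a b y : ℝ) : smoothWindow a b y ≤ 1 :=
  mul_le_one₀ (Real.smoothTransition.le_one _) (Real.smoothTransition.nonneg _)
    (Real.smoothTransition.le_one _)

theorem mem_Ioo_of_smoothWindow_ne_zero {a b y : ℝ} (ha : 0 < a) (hb : 0 < b)
    (h : smoothWindow a b y ≠ 0) : y ∈ Set.Ioo (a / 2) (2 * b) := by
  have h1 := left_ne_zero_of_mul h
  have h2 := right_ne_zero_of_mul h
  rw [Ne, Real.smoothTransition.zero_iff_nonpos, not_le] at h1 h2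
  rw [sub_pos, lt_div_iff₀ ha] at h1
  rw [sub_pos, div_lt_iff₀ hb] at h2
  exact ⟨by linarith, h2⟩

theorem smoothWindow_eq_one {a b y : ℝ} (ha : 0 < a) (hb : 0 < b) (hay : a ≤ y) (hyb : y ≤ b) :
    smoothWindow a b y = 1 := by
  have h1 : 1 ≤ 2 * y / a - 1 := by
    have : 2 ≤ 2 * y / a := by rw [le_div_iff₀ ha]; linarith
    linarith
  have h2 : 1 ≤ 2 - y / b := by
    have : y / b ≤ 1 := by rw [div_le_one hb]; exact hyb
    linarith
  rw [smoothWindow, Real.smoothTransition.one_of_one_le h1, Real.smoothTransition.one_of_one_le h2,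
    one_mul]

theorem contDiff_rieszProd (N : ℕ) (x : ℝ) :
    ContDiff ℝ ∞ fun t : ℝ => rieszProd N x (t : CircleGroup) := by
  unfold rieszProd
  exact contDiff_prod fun i _ => contDiff_const.add
    (contDiff_const.mul (contDiff_circleCos_nsmul i))

/-- A combination of Riesz products, cut off to the level set on which they concentrate. -/
noncomputable def windowedRiesz (N : ℕ) (δ : ℝ) (K : ℕ) (ν s : ℕ → ℝ) : CircleTest :=
  ⟨fun t => ((smoothWindow (N * δ / 24) (10 * N * δ) (lacunarySum N t) *
      ∑ l ∈ Finset.range (K + 1), ν l * rieszProd N (s l * δ) t : ℝ) : ℂ), by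
    have h1 : ContDiff ℝ ∞ fun x : ℝ => lacunarySum N (x : CircleGroup) :=
      ContDiff.sum fun i _ => contDiff_circleCos_nsmul i
    have h2 : ContDiff ℝ ∞ fun x : ℝ =>
        ∑ l ∈ Finset.range (K + 1), ν l * rieszProd N (s l * δ) (x : CircleGroup) :=
      ContDiff.sum fun l _ => contDiff_const.mul (contDiff_rieszProd N _)
    exact Complex.ofRealCLM.contDiff.comp (((contDiff_smoothWindow _ _).comp h1).mul h2)⟩

theorem windowedRiesz_apply (N : ℕ) (δ : ℝ) (K : ℕ) (ν s : ℕ → ℝ) (t : CircleGroup) :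
    windowedRiesz N δ K ν s t = ((smoothWindow (N * δ / 24) (10 * N * δ) (lacunarySum N t) *
      ∑ l ∈ Finset.range (K + 1), ν l * rieszProd N (s l * δ) t : ℝ) : ℂ) := rfl

/-- Cauchy–Schwarz with weights |ν l| reduces to single Riesz products. All parameters s l * δ lie
in [δ, 2δ], so one window serves them all, and δ ≤ 1/6 keeps them below 1/3. -/
theorem integral_windowedRiesz_error_sq_le {K : ℕ} {ν s : ℕ → ℝ} {V : ℝ}
    (hs : ∀ l ∈ Finset.range (K + 1), 1 ≤ s l ∧ s l ≤ 2)
    (hV : ∑ l ∈ Finset.range (K + 1), |ν l| ≤ V) {N : ℕ} (hN : 0 < N) {δ : ℝ} (hδ : 0 < δ)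
    (hδ1 : δ ≤ 1 / 6) :
    ∫ t, ((1 - smoothWindow (N * δ / 24) (10 * N * δ) (lacunarySum N t)) *
      ∑ l ∈ Finset.range (K + 1), ν l * rieszProd N (s l * δ) t) ^ 2
      ∂(AddCircle.haarAddCircle (T := 2 * Real.pi)) ≤ V ^ 2 * (2 * Real.exp (-(N * δ ^ 2 / 16))) := by
  have hNr : (0 : ℝ) < N := by exact_mod_cast hN
  set W : ℝ := ∑ l ∈ Finset.range (K + 1), |ν l| with hW
  have hW0 : 0 ≤ W := Finset.sum_nonneg fun _ _ => abs_nonneg _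
  set ψ : CircleGroup → ℝ := fun t =>
    1 - smoothWindow (N * δ / 24) (10 * N * δ) (lacunarySum N t) with hψ
  have hψc : Continuous ψ := continuous_const.sub
    ((contDiff_smoothWindow _ _).continuous.comp (continuous_lacunarySum N))
  have hRc := continuous_rieszProd N
  have hint {f : CircleGroup → ℝ} (hf : Continuous f) :
      Integrable f (AddCircle.haarAddCircle (T := 2 * Real.pi)) :=
    hf.integrable_of_hasCompactSupport (HasCompactSupport.of_compactSpace _)
  have hψz (t : CircleGroup) (ht : ψ t ≠ 0) : lacunarySum N t ≤ N * δ / 24 ∨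
      10 * N * δ ≤ lacunarySum N t := by
    by_contra! hcon
    exact ht (by rw [hψ]; simp [smoothWindow_eq_one (by positivity) (by positivity) hcon.1.le hcon.2.le])
  calc _ ≤ ∫ t, W * ∑ l ∈ Finset.range (K + 1), |ν l| * (ψ t ^ 2 * rieszProd N (s l * δ) t ^ 2)
        ∂(AddCircle.haarAddCircle (T := 2 * Real.pi)) := by
        refine integral_mono (hint ?_) (hint (by fun_prop)) fun t => ?_
        · exact (hψc.mul (by fun_prop)).pow 2
        · have h := Finset.sum_sq_le_sum_mul_sum_of_sq_le_mul (Finset.range (K + 1))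
            (r := fun l => ν l * rieszProd N (s l * δ) t) (f := fun l => |ν l|)
            (g := fun l => |ν l| * rieszProd N (s l * δ) t ^ 2) (fun _ _ => abs_nonneg _)
            (fun _ _ => by positivity) (fun l _ => le_of_eq (by rw [mul_pow, ← sq_abs (ν l)]; ring))
          change (ψ t * _) ^ 2 ≤ _
          rw [mul_pow]
          refine (mul_le_mul_of_nonneg_left h (sq_nonneg _)).trans (le_of_eq ?_)
          rw [mul_left_comm, Finset.mul_sum]
          congr 1
          exact Finset.sum_congr rfl fun l _ => by ring
    _ = W * ∑ l ∈ Finset.range (K + 1), |ν l| * ∫ t, ψ t ^ 2 * rieszProd N (s l * δ) t ^ 2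
        ∂(AddCircle.haarAddCircle (T := 2 * Real.pi)) := by
        rw [integral_const_mul, integral_finsetSum _ fun l _ => hint (by fun_prop)]
        simp only [integral_const_mul]
    _ ≤ W * ∑ l ∈ Finset.range (K + 1), |ν l| * (2 * Real.exp (-(N * δ ^ 2 / 16))) := by
        gcongr with l hl
        have hsl := hs l hl
        refine integral_cutoff_mul_rieszProd_sq_le hδ (by nlinarith) (by nlinarith) (by nlinarith)
          hψc (fun t => ?_) (fun t => ?_) hψz
        · exact sub_nonneg.2 (smoothWindow_le_one _ _ _)
        · exact sub_le_self _ (smoothWindow_nonneg _ _ _)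
    _ = W ^ 2 * (2 * Real.exp (-(N * δ ^ 2 / 16))) := by rw [← Finset.sum_mul]; ring
    _ ≤ _ := by gcongr

/-- The order of choice is λ from ε, then K from λ, then N from both, with δ = λ N^(-1/q). Since
Nδ^q = λ^q, the second bound is uniform in N and K can be fixed before N. -/
theorem exists_windowedRiesz_parameters {q : ℝ} (hq : 2 < q) {ε : ℝ} (hε : 0 < ε) :
    ∃ (K N : ℕ) (δ : ℝ), 0 < K ∧ 0 < N ∧ 0 < δ ∧ δ ≤ 1 / 6 ∧
      24 / (δ * N) * (2 * N : ℝ) ^ (1 - 1 / q) ≤ ε ∧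
      ((8 : ℝ) ^ K) ^ q * ((2 * (8 : ℝ) ^ q) ^ K)⁻¹ * (1 + 2 * (2 * (8 : ℝ) ^ q * δ ^ q)) ^ N ≤
        (ε / 2) ^ q ∧
      ((8 : ℝ) ^ K) ^ 2 * (2 * Real.exp (-(N * δ ^ 2 / 16))) ≤ (ε / 2) ^ 2 := by
  have hq0 : 0 < q := by linarith
  -- The first bound becomes 24/λ · 2^(1 - 1/q) ≤ 48/λ = ε.
  set lam : ℝ := 48 / ε with hlam
  have hlam0 : 0 < lam := by positivity
  set A : ℝ := 2 * (2 * (8 : ℝ) ^ q * lam ^ q) with hA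
  have hA0 : 0 < A := by positivity
  obtain ⟨K, hK0, hK⟩ : ∃ K : ℕ, 0 < K ∧ (1 / 2 : ℝ) ^ K * Real.exp A ≤ (ε / 2) ^ q := by
    have h1 : Filter.Tendsto (fun K : ℕ => (1 / 2 : ℝ) ^ K * Real.exp A) Filter.atTop (nhds 0) := by
      simpa using (tendsto_pow_atTop_nhds_zero_of_lt_one (r := (1 / 2 : ℝ)) (by norm_num)
        (by norm_num)).mul_const (Real.exp A)
    have h2 := h1.eventually_le_const (show (0 : ℝ) < (ε / 2) ^ q by positivity)
    exact ((Filter.eventually_gt_atTop 0).and h2).exists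
  have hNat : Filter.Tendsto (fun N : ℕ => (N : ℝ)) Filter.atTop Filter.atTop :=
    tendsto_natCast_atTop_atTop
  have hδlim : Filter.Tendsto (fun N : ℕ => lam * (N : ℝ) ^ (-(1 / q))) Filter.atTop (nhds 0) := by
    simpa using ((tendsto_rpow_neg_atTop (by positivity : 0 < 1 / q)).comp hNat).const_mul lam
  -- The decisive use of q > 2: it makes Nδ² tend to infinity.
  have hexp : 0 < 1 - 2 / q := by
    rw [sub_pos, div_lt_one hq0]; exact hq
  have htail : Filter.Tendsto (fun N : ℕ => ((8 : ℝ) ^ K) ^ 2 *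
      (2 * Real.exp (-(lam ^ 2 / 16 * (N : ℝ) ^ (1 - 2 / q))))) Filter.atTop (nhds 0) := by
    have h1 := (((tendsto_rpow_atTop hexp).comp hNat).const_mul_atTop
      (show 0 < lam ^ 2 / 16 by positivity))
    have h2 := Real.tendsto_exp_neg_atTop_nhds_zero.comp h1
    simpa using (h2.const_mul 2).const_mul (((8 : ℝ) ^ K) ^ 2)
  obtain ⟨N, hN0, hNδ, hNt⟩ := ((Filter.eventually_gt_atTop 0).and
    ((hδlim.eventually_le_const (show (0 : ℝ) < 1 / 6 by norm_num)).and
      (htail.eventually_le_const (show (0 : ℝ) < (ε / 2) ^ 2 by positivity)))).exists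
  have hNr : (0 : ℝ) < N := by exact_mod_cast hN0
  refine ⟨K, N, lam * (N : ℝ) ^ (-(1 / q)), hK0, hN0, by positivity, hNδ, ?_, ?_, ?_⟩
  · have h1 : (2 * N : ℝ) ^ (1 - 1 / q) ≤ 2 * (N : ℝ) ^ (1 - 1 / q) := by
      rw [Real.mul_rpow (by norm_num) hNr.le]
      gcongr
      refine Real.rpow_le_self_of_one_le (by norm_num) ?_
      have : 0 < 1 / q := by positivity
      linarith
    have h2 : (N : ℝ) ^ (-(1 / q)) * N = (N : ℝ) ^ (1 - 1 / q) := by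
      rw [← Real.rpow_add_one hNr.ne']
      congr 1; ring
    rw [mul_assoc, h2]
    have h3 : 0 < (N : ℝ) ^ (1 - 1 / q) := by positivity
    calc _ ≤ 24 / (lam * (N : ℝ) ^ (1 - 1 / q)) * (2 * (N : ℝ) ^ (1 - 1 / q)) := by gcongr
      _ = ε := by rw [hlam]; field_simp; norm_num
  · have h1 : (lam * (N : ℝ) ^ (-(1 / q))) ^ q = lam ^ q / N := by
      rw [Real.mul_rpow hlam0.le (by positivity), ← Real.rpow_mul hNr.le,
        show -(1 / q) * q = -1 by field_simp, Real.rpow_neg_one, div_eq_mul_inv]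
    -- The choice z = 2 · 8^q beats the mass 8^K of the signed weights by the factor 2^{-K}.
    have h2 : ((8 : ℝ) ^ K) ^ q * ((2 * (8 : ℝ) ^ q) ^ K)⁻¹ = (1 / 2) ^ K := by
      rw [← Real.rpow_natCast, ← Real.rpow_mul (by norm_num), mul_comm (K : ℝ),
        Real.rpow_mul (by norm_num), Real.rpow_natCast, mul_pow, mul_inv, one_div, inv_pow]
      have : ((8 : ℝ) ^ q) ^ K ≠ 0 := by positivity
      field_simp
    rw [h1, h2]
    refine le_trans ?_ hK
    gcongr
    have h3 := pow_le_exp_of_le_one_add (a := 1 + 2 * (2 * (8 : ℝ) ^ q * (lam ^ q / N))) (b := A / N)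
      (by positivity) (le_of_eq (by rw [hA]; ring)) N
    rwa [mul_div_cancel₀ _ hNr.ne'] at h3
  · refine le_trans (le_of_eq ?_) hNt
    congr 4
    rw [mul_pow, ← Real.rpow_natCast ((N : ℝ) ^ (-(1 / q))), ← Real.rpow_mul hNr.le,
      show (1 - 2 / q : ℝ) = -(1 / q) * (2 : ℕ) + 1 by push_cast; ring, Real.rpow_add_one hNr.ne']
    ring

/-- For `q > 2` there are smooth functions, close to `1` in the sense of `ℓ^q` norms of Fourier
coefficients, supported where a flat polynomial of small `ℓ^p` norm is bounded away from zero. -/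
theorem exists_localized_near_one {q : ℝ} (hq : 2 < q) {ε : ℝ} (hε : 0 < ε) :
    ∃ (s : Finset ℤ) (a : ℝ) (F : CircleTest) (g : lp (fun _ : ℤ => ℂ) (ENNReal.ofReal q)), 0 ≤ a ∧
      a * (s.card : ℝ) ^ (1 - 1 / q) ≤ ε ∧
      (∀ t, F t ≠ 0 → 1 ≤ (flatTrig s a t).re ∧ ‖flatTrig s a t‖ ≤ 960) ∧
      (∀ n, g n = fourierCoeff (F.toContinuousMap - 1 : C(CircleGroup, ℂ)) n) ∧ ‖g‖ ≤ ε := by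
  have hq0 : 0 < q := by linarith
  have : Fact (1 ≤ ENNReal.ofReal q) :=
    ⟨by simpa using ENNReal.ofReal_le_ofReal (by linarith : (1 : ℝ) ≤ q)⟩
  obtain ⟨K, N, δ, hK, hN, hδ, hδ1, hcard, hnear, htail⟩ := exists_windowedRiesz_parameters hq hε
  obtain ⟨ν, s, hs, h0, hmom, hV⟩ := exists_vanishing_moments hK
  have hNr : (0 : ℝ) < N := by exact_mod_cast hN
  have hz : (1 : ℝ) ≤ 2 * (8 : ℝ) ^ q := by
    have : (1 : ℝ) ≤ (8 : ℝ) ^ q := Real.one_le_rpow (by norm_num) hq0.le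
    linarith
  obtain ⟨g₁, hg₁, hg₁n⟩ := exists_lp_combination_rieszProd hq0 hs h0 hmom hV N hδ.le hz
  have hRc := continuous_rieszProd N
  set ψ : CircleGroup → ℝ := fun t =>
    1 - smoothWindow (N * δ / 24) (10 * N * δ) (lacunarySum N t) with hψ
  have hψc : Continuous ψ := continuous_const.sub
    ((contDiff_smoothWindow _ _).continuous.comp (continuous_lacunarySum N))
  let E : C(CircleGroup, ℂ) := ⟨fun t => ((ψ t *
    ∑ l ∈ Finset.range (K + 1), ν l * rieszProd N (s l * δ) t : ℝ) : ℂ),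
    Complex.continuous_ofReal.comp (by fun_prop)⟩
  obtain ⟨g₂, hg₂, hg₂n⟩ := exists_lp_of_integral_sq_le hq.le (f := E) (η := ε / 2) (by positivity) (by
    refine le_trans (le_of_eq ?_)
      ((integral_windowedRiesz_error_sq_le hs hV hN hδ hδ1).trans htail)
    congr 1
    funext t
    change ‖((_ : ℝ) : ℂ)‖ ^ 2 = _
    rw [Complex.norm_real, Real.norm_eq_abs, sq_abs])
  -- The polynomial equals 48 L / (Nδ). The window vanishes outside Nδ/48 < L < 20Nδ, which gives
  -- the bounds 1 and 960.
  refine ⟨lacunarySpectrum N, 24 / (δ * N), windowedRiesz N δ K ν s, g₁ - g₂, by positivity, ?_,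
    fun t ht => ?_, fun n => ?_, ?_⟩
  · refine le_trans ?_ hcard
    gcongr
    · have : 1 / q ≤ 1 := by rw [div_le_one hq0]; linarith
      linarith
    · exact_mod_cast card_lacunarySpectrum_le N
  · rw [windowedRiesz_apply, Ne, Complex.ofReal_eq_zero, mul_eq_zero, not_or] at ht
    have hwin := mem_Ioo_of_smoothWindow_ne_zero (by positivity) (by positivity) ht.1
    rw [flatTrig_lacunarySpectrum, Complex.ofReal_re, Complex.norm_real, Real.norm_eq_abs]
    have h1 : 2 * (24 / (δ * N)) * lacunarySum N t = 48 * lacunarySum N t / (N * δ) := by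
      field_simp; ring
    have hpos : 0 < (N : ℝ) * δ := by positivity
    have h2 : 1 ≤ 48 * lacunarySum N t / (N * δ) := by
      rw [le_div_iff₀ hpos]; linarith [hwin.1]
    rw [h1, abs_of_nonneg (by linarith)]
    refine ⟨h2, ?_⟩
    rw [div_le_iff₀ hpos]
    linarith [hwin.2]
  · have hsplit : (⇑((windowedRiesz N δ K ν s).toContinuousMap - 1 : C(CircleGroup, ℂ)) :
        CircleGroup → ℂ) = (fun t : CircleGroup =>
        ((∑ l ∈ Finset.range (K + 1), ν l * rieszProd N (s l * δ) t - 1 : ℝ) : ℂ)) +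
        (-1 : ℂ) • ⇑E := by
      funext t
      change ((_ : ℝ) : ℂ) - 1 = ((_ : ℝ) : ℂ) + (-1 : ℂ) * ((_ : ℝ) : ℂ)
      simp only [hψ]
      push_cast
      ring
    rw [hsplit, fourierCoeff.add, Pi.add_apply, fourierCoeff.const_smul, ← hg₁, ← hg₂,
      lp.coeFn_sub, Pi.sub_apply]
    · simp [sub_eq_add_neg]
    · exact (Complex.continuous_ofReal.comp (by fun_prop)).integrable_of_hasCompactSupport
        (HasCompactSupport.of_compactSpace _)
    · exact (E.continuous.const_smul _).integrable_of_hasCompactSupport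
        (HasCompactSupport.of_compactSpace _)
  · have h1 : ‖g₁‖ ≤ ε / 2 :=
      (Real.rpow_le_rpow_iff (norm_nonneg _) (by positivity) hq0).1 (hg₁n.trans hnear)
    calc ‖g₁ - g₂‖ ≤ ‖g₁‖ + ‖g₂‖ := norm_sub_le _ _
      _ ≤ ε := by linarith

theorem theorem2 (q : ℝ) (hq : 2 < q) :
    ∃ K : Set CircleGroup, IsCompact K ∧
      (∃ S : CircleTest →ₗ[ℂ] ℂ, IsCircleDistribution S ∧ S ≠ 0 ∧
        Distribution.dsupport S ⊆ K ∧ Memℓp (distFourierCoeff S) (ENNReal.ofReal q)) ∧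
      ¬ ∃ μ : ComplexMeasure CircleGroup, μ ≠ 0 ∧
        measSupport μ ⊆ K ∧ Memℓp (measFourierCoeff μ) (ENNReal.ofReal q) := by
  obtain ⟨K, hK, hflat, hS⟩ := exists_distribution_of_localized (by linarith : 1 < q)
    fun ε hε => exists_localized_near_one hq hε
  refine ⟨K, hK.isCompact, hS, ?_⟩
  rintro ⟨μ, hμ, hμK, hμq⟩
  exact hμ (μ.eq_zero_of_flatTrig (by linarith) hflat hμK hμq)
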